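/- Let $f:\mathbb R^n\to\mathbb R^n$ be continuously differentiable, let $q:\mathbb R^n\to\overline{\mathbb R}$ be proper, convex and lower semicontinuous, let $\partial q$ be its convex subdifferential and $H(x):=f(x)+\partial q(x)$. **Notions.** For $A\subset\mathbb R^m$ and $z\in A$ let $T_A(z)$ be the (Bouligand) contingent cone and $\widehat N_A(z):=T_A(z)^\circ$ (with $\widehat N_A(z):=\emptyset$ for $z\notin A$). Put $N_A(z):=\limsup_{z'\to z,\ z'\in A}\widehat N_A(z')$ and, for a direction $d$, $N_A(z;d):=\limsup_{t\downarrow0,\ d'\to d}\widehat N_A(z+td')$ (outer set limits). For a multifunction $F$ and $(x,y)\in\operatorname{gph}F$ let $D^*F(x,y)(v^*):=\{u^*\mid (u^*,-v^*)\in N_{\operatorname{gph}F}(x,y)\}$ and $D^*F((x,y);(u,v))(v^*):=\{u^*\mid (u^*,-v^*)\in N_{\operatorname{gph}F}((x,y);(u,v))\}$. $F$ is *semismooth\** at $(x,y)\in\operatorname{gph}F$ if $\langle u^*,u\rangle=\langle v^*,v\rangle$ for all $(u,v)$ and all $u^*\in D^*F((x,y);(u,v))(v^*)$. $F$ is *metrically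 regular* at $(\bar x,\bar y)\in\operatorname{gph}F$ if $\operatorname{gph}F$ is locally closed at $(\bar x,\bar y)$ and there are $\kappa\ge0$ and neighbourhoods $U$ of $\bar x$, $V$ of $\bar y$ with $\operatorname{dist}(x,F^{-1}(y))\le\kappa\operatorname{dist}(y,F(x))$ for all $(x,y)\in U\times V$. **The general step.** For $F:\mathbb R^m\rightrightarrows\mathbb R^m$ and $(z,y)\in\operatorname{gph}F$ let $\mathcal A_{\rm reg}F(z,y)$ be the set of pairs $(A,B)$ of $m\times m$ matrices with $A$ nonsingular whose $i$-th rows $u_i^*,v_i^*$ satisfy $u_i^*\in D^*F(z,y)(v_i^*)$, $i=1,\dots,m$. A step of the semismooth\* Newton method for $0\in F(z)$ takes some $(\hat z,\hat y)\in\operatorname{gph}F$ (approximation step) and some $(A,B)\in\mathcal A_{\rm reg}F(\hat z,\hat y)$, and passes to $\hat z-A^{-1}B\hat y$ (Newton step). **The method.** Fix $\gamma>0$. Given $x^{(k)}$, stop if $0\in H(x^{(k)})$. Otherwise let $$u^{(k)}:=u_\gamma(x^{(k)}):=\arg\min_u\Big(\tfrac12\gamma\|u\|^2+\langle f(x^{(k)}),u\rangle+q(x^{(k)}+u)\Big),$$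 choose any symmetric positive semidefinite $n\times n$ matrix $G^{(k)}$ with spectral norm $\|G^{(k)}\|\le1$ and $$\{((I-G^{(k)})v^*,G^{(k)}v^*)\mid v^*\in\mathbb R^n\}\subset\operatorname{gph}D^*(\partial q)\big(x^{(k)}+u^{(k)},\,-\gamma u^{(k)}-f(x^{(k)})\big),$$ and let $x^{(k+1)}$ be given by $$\big((I-G^{(k)})\nabla f(x^{(k)})+G^{(k)}\big)(x^{(k+1)}-x^{(k)})=\big(\gamma(I-G^{(k)})+G^{(k)}\big)u^{(k)}.$$ **Theorem.** Suppose that $H$ is metrically regular at $(\bar x,0)\in\operatorname{gph}H$ and that $\partial q$ is semismooth\* at $(\bar x,-f(\bar x))$. Then for every $\gamma>0$ there is a neighbourhood $U$ of $\bar x$ such that for every starting point $x^{(0)}\in U$ the following holds, whatever admissible matrices $G^{(k)}$ are chosen. 1. The method does not break down. At every iterate $x^{(k)}$ with $0\notin H(x^{(k)})$, the minimizer $u^{(k)}$ exists and is unique, an admissible $G^{(k)}$ exists, and for every admissible $G^{(k)}$ the matrix $(I-G^{(k)})\nabla f(x^{(k)})+G^{(k)}$ is nonsingular. Moreover, $(x^{(k+1)},x^{(k+1)})$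 is the outcome of a step of the semismooth\* Newton method for $0\in\mathcal F(x,d):=(f(x)+\partial q(d),\,x-d)$, with $\hat z=(x^{(k)},x^{(k)}+u^{(k)})$, $\hat y=(-\gamma u^{(k)},-u^{(k)})\in\mathcal F(\hat z)$ and $$(A,B)=\left(\begin{pmatrix}(I-G^{(k)})\nabla f(x^{(k)})&G^{(k)}\\ I&-I\end{pmatrix},\begin{pmatrix}I-G^{(k)}&0\\0&I\end{pmatrix}\right)\in\mathcal A_{\rm reg}\mathcal F(\hat z,\hat y).$$ 2. The method converges superlinearly to $\bar x$: if it stops at some $x^{(k)}$, then $x^{(k)}=\bar x$; otherwise $x^{(k)}\to\bar x$ and $\|x^{(k+1)}-\bar x\|=o(\|x^{(k)}-\bar x\|)$. -/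

import Mathlib

open Filter Topology Asymptotics
open scoped NNReal ENNReal RealInnerProductSpace Matrix

noncomputable section

namespace SemismoothNewton

section VariationalGeometry

variable {E : Type*} [NormedAddCommGroup E] [InnerProductSpace ℝ E]

/-- The tangent (contingent, Bouligand) cone to `A` at `x`, the outer limit of `(A - x) / t` as
`t ↓ 0`. -/
def contingentCone (A : Set E) (x : E) : Set E :=
  {w | ∃ (t : ℕ → ℝ) (d : ℕ → E), (∀ k, 0 < t k) ∧ Tendsto t atTop (𝓝 0) ∧
    Tendsto d atTop (𝓝 w) ∧ ∀ k, x + t k • d k ∈ A}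

/-- The regular (Fréchet) normal cone to `A` at `x`: the polar of the contingent cone if `x ∈ A`,
and empty otherwise. -/
def regularNormalCone (A : Set E) (x : E) : Set E :=
  {v | x ∈ A ∧ ∀ w ∈ contingentCone A x, ⟪v, w⟫ ≤ 0}

/-- The limiting (Mordukhovich) normal cone, the outer limit of the regular normal cones at
points of `A` that tend to `x`. -/
def limitingNormalCone (A : Set E) (x : E) : Set E :=
  {v | ∃ a b : ℕ → E, Tendsto a atTop (𝓝 x) ∧ Tendsto b atTop (𝓝 v) ∧
    ∀ k, b k ∈ regularNormalCone A (a k)}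

/-- The directional limiting normal cone to `A` at `x` in direction `d`, the outer limit of the
regular normal cones at `x + t d'` as `t ↓ 0`, `d' → d`. -/
def directionalNormalCone (A : Set E) (x d : E) : Set E :=
  {v | ∃ (t : ℕ → ℝ) (d' b : ℕ → E), (∀ k, 0 < t k) ∧ Tendsto t atTop (𝓝 0) ∧
    Tendsto d' atTop (𝓝 d) ∧ Tendsto b atTop (𝓝 v) ∧
    ∀ k, b k ∈ regularNormalCone A (x + t k • d' k)}

end VariationalGeometry

section Multifunctions

variable {E F : Type*} [NormedAddCommGroup E] [InnerProductSpace ℝ E]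
  [NormedAddCommGroup F] [InnerProductSpace ℝ F]

/-- The graph of a multifunction, in the product with the Euclidean (`ℓ²`) norm. -/
def graph (Φ : E → Set F) : Set (WithLp 2 (E × F)) :=
  {p | p.snd ∈ Φ p.fst}

/-- The limiting (Mordukhovich) coderivative `D^*Φ(x, y)`. -/
def coderivative (Φ : E → Set F) (x : E) (y : F) (v : F) : Set E :=
  {u | WithLp.toLp 2 (u, -v) ∈ limitingNormalCone (graph Φ) (WithLp.toLp 2 (x, y))}

/-- The directional limiting coderivative `D^*Φ((x, y); (a, b))`. -/
def directionalCoderivative (Φ : E → Set F) (x : E) (y : F) (a : E) (b : F) (v : F) : Set E :=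
  {u | WithLp.toLp 2 (u, -v) ∈
    directionalNormalCone (graph Φ) (WithLp.toLp 2 (x, y)) (WithLp.toLp 2 (a, b))}

/-- `Φ` is semismooth* at the point `(x, y)` of its graph. -/
def IsSemismoothStarAt (Φ : E → Set F) (x : E) (y : F) : Prop :=
  y ∈ Φ x ∧ ∀ (a : E) (b : F) (v : F), ∀ u ∈ directionalCoderivative Φ x y a b v, ⟪u, a⟫ = ⟪v, b⟫

/-- `Φ` is metrically regular around the point `(x₀, y₀)` of its graph. Distances are extended, so
that the distance to the empty set is `∞`. -/
def IsMetricallyRegularAt (Φ : E → Set F) (x₀ : E) (y₀ : F) : Prop :=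
  y₀ ∈ Φ x₀ ∧
  (∃ ε > 0, IsClosed (graph Φ ∩ Metric.closedBall (WithLp.toLp 2 (x₀, y₀)) ε)) ∧
  ∃ κ : ℝ≥0, ∃ U ∈ 𝓝 x₀, ∃ V ∈ 𝓝 y₀, ∀ x ∈ U, ∀ y ∈ V,
    Metric.infEDist x {z | y ∈ Φ z} ≤ κ * Metric.infEDist y (Φ x)

end Multifunctions

section GeneralMethod

variable {ι : Type*} [Fintype ι] [DecidableEq ι]

/-- Action of a matrix on a Euclidean vector. -/
def act (M : Matrix ι ι ℝ) (v : EuclideanSpace ℝ ι) : EuclideanSpace ℝ ι :=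
  Matrix.toEuclideanCLM (𝕜 := ℝ) M v

/-- The set `𝒜_reg Φ(x, y)` of pairs `(A, B)` whose `i`-th rows `u_i`, `v_i` satisfy
`u_i ∈ D^*Φ(x, y)(v_i)` for every `i`, with `A` nonsingular. -/
def regularMatrices (Φ : EuclideanSpace ℝ ι → Set (EuclideanSpace ℝ ι))
    (x y : EuclideanSpace ℝ ι) : Set (Matrix ι ι ℝ × Matrix ι ι ℝ) :=
  {P | (∀ i, WithLp.toLp 2 (P.1 i) ∈ coderivative Φ x y (WithLp.toLp 2 (P.2 i))) ∧
    IsUnit P.1.det}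

/-- `z'` is the outcome of the Newton step of the general semismooth* Newton method for
`0 ∈ Φ(z)`, for the outcome `(z, y)` of the approximation step and the matrices `(A, B)`. -/
def IsSemismoothNewtonStep (Φ : EuclideanSpace ℝ ι → Set (EuclideanSpace ℝ ι))
    (z y : EuclideanSpace ℝ ι) (A B : Matrix ι ι ℝ) (z' : EuclideanSpace ℝ ι) : Prop :=
  y ∈ Φ z ∧ (A, B) ∈ regularMatrices Φ z y ∧ z' = z - act (A⁻¹ * B) y

end GeneralMethod

section ConvexFunctions

variable {E : Type*} [NormedAddCommGroup E] [InnerProductSpace ℝ E]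

/-- Proper, convex, lower semicontinuous extended-real-valued functions. -/
structure IsProperConvexLsc (q : E → EReal) : Prop where
  ne_bot : ∀ x, q x ≠ ⊥
  exists_ne_top : ∃ x, q x ≠ ⊤
  convex_epigraph : Convex ℝ {p : E × ℝ | q p.1 ≤ (p.2 : EReal)}
  lsc : LowerSemicontinuous q

/-- The subdifferential of convex analysis. -/
def subdifferential (q : E → EReal) (x : E) : Set E :=
  {v | q x ≠ ⊤ ∧ ∀ z, q x + ((⟪v, z - x⟫ : ℝ) : EReal) ≤ q z}

/-- The multifunction `H = f + ∂q`. -/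
def sumMap (f : E → E) (q : E → EReal) (x : E) : Set E :=
  {y | ∃ s ∈ subdifferential q x, y = f x + s}

/-- `u = u_γ(x)`, a minimizer of `½ γ ‖u‖² + ⟨f(x), u⟩ + q(x + u)`. -/
def IsApproxStep (f : E → E) (q : E → EReal) (γ : ℝ) (x u : E) : Prop :=
  IsMinOn (fun w : E => ((1 / 2 * γ * ‖w‖ ^ 2 + ⟪f x, w⟫ : ℝ) : EReal) + q (x + w)) Set.univ u

end ConvexFunctions

section Method

variable {n : ℕ}

/-- The vector `(x, d) ∈ ℝⁿ × ℝⁿ`. -/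
def pair (x d : EuclideanSpace ℝ (Fin n)) : EuclideanSpace ℝ (Fin n ⊕ Fin n) :=
  WithLp.toLp 2 (Sum.elim (fun i => x i) (fun i => d i))

/-- The multifunction `𝓕(x, d) = (f(x) + ∂q(d), x - d)`. -/
def productMap (f : EuclideanSpace ℝ (Fin n) → EuclideanSpace ℝ (Fin n))
    (q : EuclideanSpace ℝ (Fin n) → EReal) (z : EuclideanSpace ℝ (Fin n ⊕ Fin n)) :
    Set (EuclideanSpace ℝ (Fin n ⊕ Fin n)) :=
  {w | ∃ x d s : EuclideanSpace ℝ (Fin n),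
    z = pair x d ∧ s ∈ subdifferential q d ∧ w = pair (f x + s) (x - d)}

/-- The Jacobian matrix `∇f(x)`. -/
def jacobian (f : EuclideanSpace ℝ (Fin n) → EuclideanSpace ℝ (Fin n))
    (x : EuclideanSpace ℝ (Fin n)) : Matrix (Fin n) (Fin n) ℝ :=
  (Matrix.toEuclideanCLM (𝕜 := ℝ) (n := Fin n)).symm (fderiv ℝ f x)

/-- `G` is symmetric positive semidefinite with spectral norm at most one, and
`{((I - G) v, G v) | v ∈ ℝⁿ} ⊆ gph D^*(∂q)(d, d')`. -/
def IsSubdiffMatrix (q : EuclideanSpace ℝ (Fin n) → EReal) (d d' : EuclideanSpace ℝ (Fin n))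
    (G : Matrix (Fin n) (Fin n) ℝ) : Prop :=
  G.PosSemidef ∧ ‖Matrix.toEuclideanCLM (𝕜 := ℝ) G‖ ≤ 1 ∧
    ∀ v, act G v ∈ coderivative (subdifferential q) d d' (act (1 - G) v)

/-- The matrix `(I - G) ∇f(x) + G` of the reduced Newton system. -/
def newtonMatrix (f : EuclideanSpace ℝ (Fin n) → EuclideanSpace ℝ (Fin n))
    (G : Matrix (Fin n) (Fin n) ℝ) (x : EuclideanSpace ℝ (Fin n)) : Matrix (Fin n) (Fin n) ℝ :=
  (1 - G) * jacobian f x + G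

/-- The reduced Newton system
`((I - G) ∇f(x) + G) (x' - x) = (γ (I - G) + G) u`. -/
def IsReducedNewtonStep (f : EuclideanSpace ℝ (Fin n) → EuclideanSpace ℝ (Fin n)) (γ : ℝ)
    (G : Matrix (Fin n) (Fin n) ℝ) (u x x' : EuclideanSpace ℝ (Fin n)) : Prop :=
  act (newtonMatrix f G x) (x' - x) = act (γ • (1 - G) + G) u

/-- One iteration of the method with scaling parameter `γ`, from `x` to `x'`: the stopping test
fails at `x`, then come the approximation step, the choice of some admissible `G`, and the
Newton step. -/
def IsIteration (f : EuclideanSpace ℝ (Fin n) → EuclideanSpace ℝ (Fin n))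
    (q : EuclideanSpace ℝ (Fin n) → EReal) (γ : ℝ) (x x' : EuclideanSpace ℝ (Fin n)) : Prop :=
  0 ∉ sumMap f q x ∧
  ∃ u G, IsApproxStep f q γ x u ∧ IsSubdiffMatrix q (x + u) (-(γ • u) - f x) G ∧
    IsReducedNewtonStep f γ G u x x'

/-- The iteration can be carried out at `x`: `u_γ(x)` is well defined, an admissible matrix `G`
exists, and for every admissible `G` the Newton system is nonsingular and its solution `x'`
is the outcome `(x', x')` of a step of the general semismooth* Newton method for `0 ∈ 𝓕(x, d)`,
taken from the point `((x, x + u), (-γ u, -u))` with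
`A = [(I - G) ∇f(x), G; I, -I]` and `B = [I - G, 0; 0, I]`. -/
def IsIterationWellDefined (f : EuclideanSpace ℝ (Fin n) → EuclideanSpace ℝ (Fin n))
    (q : EuclideanSpace ℝ (Fin n) → EReal) (γ : ℝ) (x : EuclideanSpace ℝ (Fin n)) : Prop :=
  (∃! u, IsApproxStep f q γ x u) ∧
  ∀ u, IsApproxStep f q γ x u →
    (∃ G, IsSubdiffMatrix q (x + u) (-(γ • u) - f x) G) ∧
    ∀ G, IsSubdiffMatrix q (x + u) (-(γ • u) - f x) G →
      IsUnit (newtonMatrix f G x).det ∧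
      ∀ x', IsReducedNewtonStep f γ G u x x' →
        IsSemismoothNewtonStep (productMap f q) (pair x (x + u)) (pair (-(γ • u)) (-u))
          (Matrix.fromBlocks ((1 - G) * jacobian f x) G 1 (-1))
          (Matrix.fromBlocks (1 - G) 0 0 1) (pair x' x')

end Method

end SemismoothNewton

end

open SemismoothNewton

/-!
With `d = x + u` and `s = -γ u - f(x)`, optimality of the approximation step reads `s ∈ ∂q(d)`,
and monotonicity of `∂q` gives `‖d - x̄‖ + ‖s + f(x̄)‖ = O(‖x - x̄‖)`
(`norm_sub_le_of_mem_subdifferential`).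

*Admissible matrices exist.* The graph of `∂q` is the image of `w ↦ (w - Q w, Q w)`, where
`Q = id - prox_q` is nonexpansive. By Rademacher's theorem `Q` is differentiable on a dense set. Its
derivatives are symmetric, since `Q` is the gradient of the Moreau envelope, and positive
semidefinite of norm at most one, since `Q` is firmly nonexpansive. Such a derivative `D` produces
the regular normals `(D v, -(I - D) v)`, and a limit of such derivatives along `w → d + s` is an
admissible `G` (`exists_subdiff_operator`).

*The Newton systems are uniformly invertible.* Metric regularity of `H` bounds `v` by
`κ ‖∇f(d)ᵀ v + u‖` whenever `u ∈ D^*(∂q)(d, s)(v)` with `(d, s)` near `(x̄, -f(x̄))`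
(`IsMetricallyRegularAt.exists_coderivative_bound`). Inserting `((I - G) v, G v)` bounds the
transposed Newton operators from below (`IsMetricallyRegularAt.exists_newtonOperator_bound`).

*Superlinear contraction.* The Newton system maps the new error `x' - x̄` to
`(I - G) [∇f(x) (x - x̄) - f(x) + f(x̄)] + [G (d - x̄) - (I - G) (s + f(x̄))]`. The first bracket is
`o(‖x - x̄‖)` because `f` is continuously differentiable. By symmetry of `G`, pairing the second one
with `v` gives `⟨G v, d - x̄⟩ - ⟨(I - G) v, s + f(x̄)⟩`, which is the quantity that
semismoothness* makes small, uniformly over coderivatives at nearby points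
(`IsSemismoothStarAt.inner_sub_inner_le`). This gives `exists_newton_step_contraction`. Applied at
a solution `x` with `u = 0` and `x' = x`, it also shows that `x̄` is an isolated solution.

The identification with a step of the general method needs normals to the graph of `𝓕`, built from
those of `∂q` in `pair_mem_coderivative_productMap`, and a Schur complement for nonsingularity.
-/

open SemismoothNewton

namespace SemismoothNewton

/-! ### Convex functions and the approximation step -/

section ConvexAnalysis

variable {E : Type*} [NormedAddCommGroup E] [InnerProductSpace ℝ E] {q : E → EReal}

theorem IsProperConvexLsc.exists_eq_coe (hq : IsProperConvexLsc q) {x : E} (hx : q x ≠ ⊤) :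
    ∃ r : ℝ, q x = r :=
  ⟨(q x).toReal, (EReal.coe_toReal hx (hq.ne_bot x)).symm⟩

theorem IsProperConvexLsc.le_combo (hq : IsProperConvexLsc q) {x y : E} {r s t : ℝ}
    (hx : q x ≤ r) (hy : q y ≤ s) (h0 : 0 ≤ t) (h1 : t ≤ 1) :
    q (x + t • (y - x)) ≤ ((r + t * (s - r) : ℝ) : EReal) := by
  have h := hq.convex_epigraph (x := (x, r)) hx (y := (y, s)) hy (sub_nonneg.2 h1) h0
    (sub_add_cancel 1 t)
  simp only [Set.mem_ofPred_eq, Prod.smul_mk, Prod.mk_add_mk, smul_eq_mul] at h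
  convert h using 2
  · module
  · ring_nf

/-- The convexity inequality on a segment that leaves a ball turns a lower bound on the ball into
a minorant of linear growth. -/
theorem IsProperConvexLsc.exists_linear_minorant [FiniteDimensional ℝ E]
    (hq : IsProperConvexLsc q) :
    ∃ a b : ℝ, 0 ≤ b ∧ ∀ (y : E) (t : ℝ), q y ≤ t → a - b * ‖y‖ ≤ t := by
  obtain ⟨x₀, hx₀⟩ := hq.exists_ne_top
  obtain ⟨r₀, hr₀⟩ := hq.exists_eq_coe hx₀
  obtain ⟨z₀, -, hmin⟩ := (hq.lsc.lowerSemicontinuousOn (Metric.closedBall x₀ 1)).exists_isMinOn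
    ⟨x₀, by simp⟩ (isCompact_closedBall x₀ 1)
  have hz₀ : q z₀ ≤ r₀ := hr₀ ▸ hmin (by simp : x₀ ∈ Metric.closedBall x₀ 1)
  obtain ⟨m, hm⟩ := hq.exists_eq_coe (ne_top_of_le_ne_top (EReal.coe_ne_top _) hz₀)
  have hmr : m ≤ r₀ := by rw [hm] at hz₀; exact_mod_cast hz₀
  refine ⟨m - (r₀ - m) * ‖x₀‖, r₀ - m, by linarith, fun y t hyt => ?_⟩
  have hn : ‖y - x₀‖ ≤ ‖y‖ + ‖x₀‖ := norm_sub_le _ _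
  have hn' := mul_le_mul_of_nonneg_left hn (sub_nonneg.2 hmr)
  rcases le_or_gt ‖y - x₀‖ 1 with h | h
  · have : q z₀ ≤ q y := hmin (by simpa [dist_eq_norm] using h)
    rw [hm] at this
    have : m ≤ t := by exact_mod_cast this.trans hyt
    have : 0 ≤ (r₀ - m) * ‖y - x₀‖ := mul_nonneg (by linarith) (norm_nonneg _)
    linarith
  · have hpos : 0 < ‖y - x₀‖ := by linarith
    have h1 := hq.le_combo hr₀.le hyt (t := ‖y - x₀‖⁻¹) (by positivity) (inv_le_one_of_one_le₀ h.le)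
    have h2 : q z₀ ≤ q (x₀ + ‖y - x₀‖⁻¹ • (y - x₀)) := hmin (by
      simp [norm_smul, hpos.ne'])
    rw [hm] at h2
    have h3 : m ≤ r₀ + ‖y - x₀‖⁻¹ * (t - r₀) := by exact_mod_cast h2.trans h1
    have h4 := mul_le_mul_of_nonneg_left h3 hpos.le
    have h5 : ‖y - x₀‖ * (r₀ + ‖y - x₀‖⁻¹ * (t - r₀)) = ‖y - x₀‖ * r₀ + (t - r₀) := by
      field_simp
    rw [h5] at h4
    nlinarith

theorem subdifferential_le (hq : IsProperConvexLsc q) {x y s : E} (hs : s ∈ subdifferential q x)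
    (hy : q y ≠ ⊤) : (q x).toReal + ⟪s, y - x⟫ ≤ (q y).toReal := by
  have h := hs.2 y
  rw [← EReal.coe_toReal hs.1 (hq.ne_bot x), ← EReal.coe_toReal hy (hq.ne_bot y)] at h
  exact_mod_cast h

theorem subdifferential_monotone (hq : IsProperConvexLsc q) {x y s t : E}
    (hs : s ∈ subdifferential q x) (ht : t ∈ subdifferential q y) : 0 ≤ ⟪s - t, x - y⟫ := by
  have h1 := subdifferential_le hq hs ht.1
  have h2 := subdifferential_le hq ht hs.1
  have h3 : ⟪s, y - x⟫ = -⟪s, x - y⟫ := by rw [← inner_neg_right, neg_sub]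
  rw [inner_sub_left]
  linarith

/-- The first-order optimality condition of the approximation step. -/
theorem IsApproxStep.mem_subdifferential (hq : IsProperConvexLsc q) {f : E → E} {γ : ℝ} {x u : E}
    (h : IsApproxStep f q γ x u) : -(γ • u) - f x ∈ subdifferential q (x + u) := by
  have hmin : ∀ w, ((1 / 2 * γ * ‖u‖ ^ 2 + ⟪f x, u⟫ : ℝ) : EReal) + q (x + u) ≤
      ((1 / 2 * γ * ‖w‖ ^ 2 + ⟪f x, w⟫ : ℝ) : EReal) + q (x + w) := fun w => h (Set.mem_univ w)
  have hfin : q (x + u) ≠ ⊤ := by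
    obtain ⟨x₀, hx₀⟩ := hq.exists_ne_top
    obtain ⟨r₀, hr₀⟩ := hq.exists_eq_coe hx₀
    have := hmin (x₀ - x)
    rw [add_sub_cancel, hr₀] at this
    intro htop
    rw [htop, EReal.coe_add_top, top_le_iff, ← EReal.coe_add] at this
    exact EReal.coe_ne_top _ this
  refine ⟨hfin, fun z => ?_⟩
  by_cases hz : q z = ⊤
  · rw [hz]; exact le_top
  obtain ⟨r, hr⟩ := hq.exists_eq_coe hfin
  obtain ⟨s, hs⟩ := hq.exists_eq_coe hz
  rw [hr, hs]
  norm_cast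
  set e := z - (x + u)
  have key : ∀ t : ℝ, t ∈ Set.Ioc (0 : ℝ) 1 →
      r + ⟪-(γ • u) - f x, e⟫ ≤ s + t * (1 / 2 * γ * ‖e‖ ^ 2) := by
    intro t ⟨ht0, ht1⟩
    have h1 := hmin (u + t • e)
    have h2 := hq.le_combo hr.le hs.le ht0.le ht1
    rw [← add_assoc] at h1
    have h3 := h1.trans (add_le_add_right h2 _)
    rw [hr] at h3
    norm_cast at h3
    have h4 : ‖u + t • e‖ ^ 2 = ‖u‖ ^ 2 + 2 * t * ⟪u, e⟫ + t ^ 2 * ‖e‖ ^ 2 := by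
      rw [norm_add_sq_real, inner_smul_right, norm_smul, Real.norm_eq_abs, mul_pow, sq_abs]; ring
    rw [h4, inner_add_right, inner_smul_right] at h3
    rw [inner_sub_left, inner_neg_left, real_inner_smul_left]
    have h5 : t * (r + (-(γ * ⟪u, e⟫) - ⟪f x, e⟫)) ≤ t * (s + t * (1 / 2 * γ * ‖e‖ ^ 2)) := by
      linarith
    exact le_of_mul_le_mul_left h5 ht0
  have hlim : Tendsto (fun t : ℝ => s + t * (1 / 2 * γ * ‖e‖ ^ 2)) (𝓝[>] 0)
      (𝓝 (s + 0 * (1 / 2 * γ * ‖e‖ ^ 2))) :=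
    ((continuous_const.add (continuous_id.mul continuous_const)).tendsto 0).mono_left
      nhdsWithin_le_nhds
  rw [zero_mul, add_zero] at hlim
  exact ge_of_tendsto hlim (Filter.mem_of_superset (Ioc_mem_nhdsGT one_pos) key)

/-- The objective is lower semicontinuous and, by the linear minorant of `q`, coercive. -/
theorem exists_isApproxStep [FiniteDimensional ℝ E] (hq : IsProperConvexLsc q) (f : E → E) {γ : ℝ}
    (hγ : 0 < γ) (x : E) : ∃ u, IsApproxStep f q γ x u := by
  obtain ⟨a, b, hb, hab⟩ := hq.exists_linear_minorant
  obtain ⟨x₀, hx₀⟩ := hq.exists_ne_top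
  obtain ⟨r₀, hr₀⟩ := hq.exists_eq_coe hx₀
  set φ : E → EReal := fun w => ((1 / 2 * γ * ‖w‖ ^ 2 + ⟪f x, w⟫ : ℝ) : EReal) + q (x + w)
    with hφ
  set c := 1 / 2 * γ * ‖x₀ - x‖ ^ 2 + ⟪f x, x₀ - x⟫ + r₀ with hc
  have hφ₀ : φ (x₀ - x) = c := by
    simp only [hφ, add_sub_cancel, hr₀]; norm_cast
  set β := ‖f x‖ + b with hβ
  set δ := |a - b * ‖x‖ - c| with hδ
  -- `R` is so large that `½ γ r ≥ β + δ` and `r ≥ 1` for `r ≥ R`; the last summand puts `x₀ - x`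
  -- into the ball of radius `R`.
  set R := 1 + 2 * (β + δ) / γ + ‖x₀ - x‖ with hR
  have hβ0 : 0 ≤ β := by positivity
  have hδ0 : 0 ≤ δ := abs_nonneg _
  have hfar : ∀ w, R ≤ ‖w‖ → (c : EReal) ≤ φ w := by
    intro w hw
    by_cases hw' : q (x + w) = ⊤
    · simp only [hφ, hw', EReal.coe_add_top, le_top]
    obtain ⟨s, hs⟩ := hq.exists_eq_coe hw'
    simp only [hφ, hs]
    norm_cast
    have h1 := hab _ _ hs.le
    have h2 : b * ‖x + w‖ ≤ b * (‖x‖ + ‖w‖) := mul_le_mul_of_nonneg_left (norm_add_le _ _) hb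
    have h3 : -(‖f x‖ * ‖w‖) ≤ ⟪f x, w⟫ := neg_le_of_abs_le (abs_real_inner_le_norm _ _)
    have h4 : 0 ≤ 2 * (β + δ) / γ := by positivity
    have h5 : 1 ≤ ‖w‖ := by linarith [norm_nonneg (x₀ - x)]
    have h6 : 2 * (β + δ) / γ ≤ ‖w‖ := by linarith [norm_nonneg (x₀ - x)]
    rw [div_le_iff₀ hγ] at h6
    have h7 : (β + δ) * ‖w‖ ≤ 1 / 2 * γ * ‖w‖ ^ 2 := by nlinarith
    have h8 : δ ≤ δ * ‖w‖ := le_mul_of_one_le_right hδ0 h5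
    have h9 : -δ ≤ a - b * ‖x‖ - c := neg_abs_le _
    nlinarith
  have hqc : LowerSemicontinuous fun w => q (x + w) := fun w y hy =>
    (continuous_const_add x).continuousAt.eventually (hq.lsc (x + w) y hy)
  have hlsc : LowerSemicontinuous φ := by
    refine LowerSemicontinuous.add' ?_ hqc ?_
    · exact (continuous_coe_real_ereal.comp (by fun_prop)).lowerSemicontinuous
    · intro w
      exact EReal.continuousAt_add (Or.inl (EReal.coe_ne_top _)) (Or.inl (EReal.coe_ne_bot _))
  have hR0 : ‖x₀ - x‖ ≤ R := by
    have : 0 ≤ 2 * (β + δ) / γ := by positivity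
    linarith
  have hmem : x₀ - x ∈ Metric.closedBall (0 : E) R := by simpa using hR0
  obtain ⟨u, -, hu⟩ := (hlsc.lowerSemicontinuousOn (Metric.closedBall (0 : E) R)).exists_isMinOn
    ⟨_, hmem⟩ (isCompact_closedBall _ _)
  refine ⟨u, fun w _ => ?_⟩
  rcases le_total ‖w‖ R with h | h
  · exact hu (by simpa using h)
  · exact ((hu hmem).trans hφ₀.le).trans (hfar w h)

theorem IsApproxStep.unique (hq : IsProperConvexLsc q) {f : E → E} {γ : ℝ} (hγ : 0 < γ)
    {x u v : E} (hu : IsApproxStep f q γ x u) (hv : IsApproxStep f q γ x v) : u = v := by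
  have h := subdifferential_monotone hq (hu.mem_subdifferential hq) (hv.mem_subdifferential hq)
  have h1 : -(γ • u) - f x - (-(γ • v) - f x) = -(γ • (u - v)) := by module
  rw [h1, add_sub_add_left_eq_sub, inner_neg_left, real_inner_smul_left,
    real_inner_self_eq_norm_sq] at h
  have h2 : ‖u - v‖ ^ 2 ≤ 0 := by nlinarith
  exact sub_eq_zero.1 (norm_eq_zero.1 (pow_eq_zero_iff two_ne_zero |>.1
    (le_antisymm h2 (sq_nonneg _))))

end ConvexAnalysis

/-! ### Coderivatives through sequences -/

section Coderivatives

theorem tendsto_toLp_prod {E F α : Type*} [NormedAddCommGroup E] [NormedAddCommGroup F]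
    {l : Filter α} {a : α → E} {b : α → F}
    {x : E} {y : F} :
    Tendsto (fun k => WithLp.toLp 2 (a k, b k)) l (𝓝 (WithLp.toLp 2 (x, y))) ↔
      Tendsto a l (𝓝 x) ∧ Tendsto b l (𝓝 y) := by
  rw [← Prod.tendsto_iff (fun k => (a k, b k)) (x, y)]
  constructor
  · intro h
    exact ((WithLp.prod_continuous_ofLp 2 E F).tendsto _).comp h
  · intro h
    exact ((WithLp.prod_continuous_toLp 2 E F).tendsto _).comp h

variable {E F : Type*} [NormedAddCommGroup E] [InnerProductSpace ℝ E]
  [NormedAddCommGroup F] [InnerProductSpace ℝ F] {Φ : E → Set F}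

/-- The regular (Fréchet) coderivative `D̂^*Φ(x, y)`, whose outer limit at points of the graph is
the limiting coderivative. -/
def regularCoderivative (Φ : E → Set F) (x : E) (y : F) (v : F) : Set E :=
  {u | WithLp.toLp 2 (u, -v) ∈ regularNormalCone (graph Φ) (WithLp.toLp 2 (x, y))}

theorem mem_contingentCone_graph_iff {x : E} {y : F} {a : E} {b : F} :
    WithLp.toLp 2 (a, b) ∈ contingentCone (graph Φ) (WithLp.toLp 2 (x, y)) ↔
      ∃ (t : ℕ → ℝ) (h : ℕ → E) (c : ℕ → F), (∀ k, 0 < t k) ∧ Tendsto t atTop (𝓝 0) ∧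
        Tendsto h atTop (𝓝 a) ∧ Tendsto c atTop (𝓝 b) ∧ ∀ k, y + t k • c k ∈ Φ (x + t k • h k) := by
  constructor
  · rintro ⟨t, d, ht, ht0, hd, hmem⟩
    have hd' := tendsto_toLp_prod (a := fun k => (d k).fst) (b := fun k => (d k).snd) |>.1 hd
    exact ⟨t, _, _, ht, ht0, hd'.1, hd'.2, hmem⟩
  · rintro ⟨t, h, c, ht, ht0, hh, hc, hmem⟩
    exact ⟨t, fun k => WithLp.toLp 2 (h k, c k), ht, ht0, tendsto_toLp_prod.2 ⟨hh, hc⟩, hmem⟩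

theorem mem_regularCoderivative_iff {x : E} {y : F} {u : E} {v : F} :
    u ∈ regularCoderivative Φ x y v ↔ y ∈ Φ x ∧ ∀ a b,
      WithLp.toLp 2 (a, b) ∈ contingentCone (graph Φ) (WithLp.toLp 2 (x, y)) →
        ⟪u, a⟫ ≤ ⟪v, b⟫ := by
  refine and_congr Iff.rfl ⟨fun h a b hab => ?_, fun h w hw => ?_⟩
  · have := h _ hab
    rw [WithLp.prod_inner_apply] at this
    simpa using this
  · have := h w.fst w.snd hw
    rw [WithLp.prod_inner_apply]
    simpa using this

theorem mem_coderivative_iff {x : E} {y : F} {u : E} {v : F} :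
    u ∈ coderivative Φ x y v ↔ ∃ (xs : ℕ → E) (ys : ℕ → F) (us : ℕ → E) (vs : ℕ → F),
      Tendsto xs atTop (𝓝 x) ∧ Tendsto ys atTop (𝓝 y) ∧ Tendsto us atTop (𝓝 u) ∧
      Tendsto vs atTop (𝓝 v) ∧ ∀ k, us k ∈ regularCoderivative Φ (xs k) (ys k) (vs k) := by
  constructor
  · rintro ⟨a, b, ha, hb, hab⟩
    have ha' := tendsto_toLp_prod (a := fun k => (a k).fst) (b := fun k => (a k).snd) |>.1 ha
    have hb' := tendsto_toLp_prod (a := fun k => (b k).fst) (b := fun k => (b k).snd) |>.1 hb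
    refine ⟨_, _, _, fun k => -(b k).snd, ha'.1, ha'.2, hb'.1, by simpa using hb'.2.neg,
      fun k => ?_⟩
    simp only [regularCoderivative, neg_neg]
    exact hab k
  · rintro ⟨xs, ys, us, vs, hx, hy, hu, hv, h⟩
    exact ⟨fun k => WithLp.toLp 2 (xs k, ys k), fun k => WithLp.toLp 2 (us k, -vs k),
      tendsto_toLp_prod.2 ⟨hx, hy⟩, tendsto_toLp_prod.2 ⟨hu, hv.neg⟩, h⟩

end Coderivatives

/-! ### The resolvent of the subdifferential and its derivatives -/

section Resolvent

variable {E : Type*} [NormedAddCommGroup E] [InnerProductSpace ℝ E] {q : E → EReal} {Q : E → E}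

/-- Every `w` splits as `p + s` with `s ∈ ∂q(p)`; this is the existence of the proximal point. -/
theorem exists_resolvent_complement [FiniteDimensional ℝ E] (hq : IsProperConvexLsc q) :
    ∃ Q : E → E, ∀ w, Q w ∈ subdifferential q (w - Q w) := by
  have h : ∀ w, ∃ s, s ∈ subdifferential q (w - s) := fun w => by
    obtain ⟨u, hu⟩ := exists_isApproxStep hq (fun _ => 0) one_pos w
    have := hu.mem_subdifferential hq
    rw [one_smul, sub_zero] at this
    exact ⟨-u, by rwa [sub_neg_eq_add]⟩
  choose Q hQ using h
  exact ⟨Q, hQ⟩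

/-- Minty parametrization: `d + s` determines `s` on the graph of `∂q`. -/
theorem resolvent_complement_add (hq : IsProperConvexLsc q)
    (hQ : ∀ w, Q w ∈ subdifferential q (w - Q w)) {d s : E} (hs : s ∈ subdifferential q d) :
    Q (d + s) = s := by
  have h := subdifferential_monotone hq (hQ (d + s)) hs
  have h1 : d + s - Q (d + s) - d = -(Q (d + s) - s) := by abel
  rw [h1, inner_neg_right, real_inner_self_eq_norm_sq] at h
  have h2 : ‖Q (d + s) - s‖ ^ 2 = 0 := le_antisymm (by linarith) (sq_nonneg _)
  exact sub_eq_zero.1 (norm_eq_zero.1 (pow_eq_zero_iff two_ne_zero |>.1 h2))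

theorem resolvent_complement_firmly_nonexpansive (hq : IsProperConvexLsc q)
    (hQ : ∀ w, Q w ∈ subdifferential q (w - Q w)) (v w : E) :
    ‖Q v - Q w‖ ^ 2 ≤ ⟪Q v - Q w, v - w⟫ := by
  have h := subdifferential_monotone hq (hQ v) (hQ w)
  have h1 : v - Q v - (w - Q w) = (v - w) - (Q v - Q w) := by abel
  rw [h1, inner_sub_right, real_inner_self_eq_norm_sq] at h
  linarith

theorem resolvent_complement_lipschitz (hq : IsProperConvexLsc q)
    (hQ : ∀ w, Q w ∈ subdifferential q (w - Q w)) : LipschitzWith 1 Q := by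
  refine LipschitzWith.of_dist_le_mul fun v w => ?_
  rw [NNReal.coe_one, one_mul, dist_eq_norm, dist_eq_norm]
  have h := (resolvent_complement_firmly_nonexpansive hq hQ v w).trans (real_inner_le_norm _ _)
  rcases (norm_nonneg (Q v - Q w)).eq_or_lt with h0 | h0
  · rw [← h0]; exact norm_nonneg _
  · rw [sq] at h; exact le_of_mul_le_mul_left h h0

theorem moreau_envelope_le (hq : IsProperConvexLsc q)
    (hQ : ∀ w, Q w ∈ subdifferential q (w - Q w)) (v w : E) :
    (q (v - Q v)).toReal + 1 / 2 * ‖Q v‖ ^ 2 ≤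
      (q (w - Q w)).toReal + 1 / 2 * ‖v - w + Q w‖ ^ 2 := by
  have h := subdifferential_le hq (hQ v) (hQ w).1
  have h1 : v - w + Q w = Q v - (w - Q w - (v - Q v)) := by abel
  rw [h1, norm_sub_sq_real]
  nlinarith [sq_nonneg ‖w - Q w - (v - Q v)‖]

/-- `Q = id - prox_q` is the gradient of the Moreau envelope of `q`. -/
theorem hasFDerivAt_moreau_envelope (hq : IsProperConvexLsc q)
    (hQ : ∀ w, Q w ∈ subdifferential q (w - Q w)) (w : E) :
    HasFDerivAt (fun w => (q (w - Q w)).toReal + 1 / 2 * ‖Q w‖ ^ 2) (innerSL ℝ (Q w)) w := by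
  rw [hasFDerivAt_iff_isLittleO_nhds_zero]
  refine IsBigO.trans_isLittleO (g := fun h : E => ‖h‖ ^ 2) ?_ ?_
  · refine IsBigO.of_bound 2 (Eventually.of_forall fun h => ?_)
    have h1 := moreau_envelope_le hq hQ (w + h) w
    have h2 := moreau_envelope_le hq hQ w (w + h)
    have h3 : ‖Q (w + h) - Q w‖ ≤ ‖h‖ := by
      simpa [dist_eq_norm] using (resolvent_complement_lipschitz hq hQ).dist_le_mul (w + h) w
    have h4 : -(‖h‖ * ‖h‖) ≤ ⟪Q (w + h) - Q w, h⟫ :=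
      neg_le_of_abs_le ((abs_real_inner_le_norm _ _).trans
        (mul_le_mul_of_nonneg_right h3 (norm_nonneg _)))
    have e1 : w + h - w + Q w = Q w + h := by abel
    have e2 : w - (w + h) + Q (w + h) = Q (w + h) - h := by abel
    rw [e1, norm_add_sq_real] at h1
    rw [e2, norm_sub_sq_real] at h2
    rw [inner_sub_left] at h4
    rw [innerSL_apply_apply, Real.norm_eq_abs, norm_pow, norm_norm, abs_le]
    constructor <;> nlinarith
  · have : (fun h : E => ‖h‖ ^ 2) =o[𝓝 0] fun h : E => ‖h‖ ^ 1 :=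
      isLittleO_norm_pow_norm_pow one_lt_two
    simp only [pow_one] at this
    exact this.of_norm_right

/-- The derivative of a gradient is symmetric. -/
theorem inner_fderiv_resolvent_complement_symm (hq : IsProperConvexLsc q)
    (hQ : ∀ w, Q w ∈ subdifferential q (w - Q w)) {w : E} {D : E →L[ℝ] E}
    (hD : HasFDerivAt Q D w) (v h : E) : ⟪D v, h⟫ = ⟪v, D h⟫ := by
  let B : E →L[ℝ] E →L[ℝ] ℝ := innerSL ℝ
  have h1 : HasFDerivAt (fun w => B (Q w)) (B.comp D) w := B.hasFDerivAt.comp w hD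
  have h2 := second_derivative_symmetric (f' := fun w => B (Q w))
    (hasFDerivAt_moreau_envelope hq hQ) h1 v h
  have h3 : ⟪D v, h⟫ = ⟪D h, v⟫ := h2
  rw [h3, real_inner_comm]

/-- Firm nonexpansiveness of `Q` passes to its derivative, which is thus positive. -/
theorem norm_fderiv_resolvent_complement_sq_le (hq : IsProperConvexLsc q)
    (hQ : ∀ w, Q w ∈ subdifferential q (w - Q w)) {w : E} {D : E →L[ℝ] E}
    (hD : HasFDerivAt Q D w) (h : E) : ‖D h‖ ^ 2 ≤ ⟪D h, h⟫ := by
  have hlim : Tendsto (fun t : ℝ => t⁻¹ • (Q (w + t • h) - Q w)) (𝓝[≠] 0) (𝓝 (D h)) := by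
    have := (hD.hasLineDerivAt h).tendsto_slope_zero
    simpa using this
  refine le_of_tendsto_of_tendsto (hlim.norm.pow 2) (hlim.inner (tendsto_const_nhds (x := h))) ?_
  filter_upwards [self_mem_nhdsWithin] with t ht
  have h1 := resolvent_complement_firmly_nonexpansive hq hQ (w + t • h) w
  rw [add_sub_cancel_left, inner_smul_right] at h1
  have ht : t ≠ 0 := ht
  rw [norm_smul, real_inner_smul_left, mul_pow, Real.norm_eq_abs, sq_abs]
  calc t⁻¹ ^ 2 * ‖Q (w + t • h) - Q w‖ ^ 2 ≤ t⁻¹ ^ 2 * (t * ⟪Q (w + t • h) - Q w, h⟫) :=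
        mul_le_mul_of_nonneg_left h1 (sq_nonneg _)
    _ = _ := by field_simp

/-- Where `Q` is differentiable, the contingent cone to `gph ∂q` lies in the range of
`h ↦ (h - D h, D h)`. -/
theorem eq_fderiv_of_mem_contingentCone (hq : IsProperConvexLsc q)
    (hQ : ∀ w, Q w ∈ subdifferential q (w - Q w)) {w : E} {D : E →L[ℝ] E}
    (hD : HasFDerivAt Q D w) {a b : E}
    (hab : WithLp.toLp 2 (a, b) ∈
      contingentCone (graph (subdifferential q)) (WithLp.toLp 2 (w - Q w, Q w))) :
    b = D (a + b) := by
  obtain ⟨t, h, c, ht, ht0, hh, hc, hmem⟩ := mem_contingentCone_graph_iff.1 hab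
  have hlim := (hD.hasFDerivWithinAt (s := Set.univ)).lim (l := atTop) (c := fun k => (t k)⁻¹)
    (d := fun k => t k • (h k + c k)) (v := a + b) (by simpa using ht0.smul (hh.add hc))
    (by simp) (by
      refine (hh.add hc).congr fun k => ?_
      rw [inv_smul_smul₀ (ht k).ne'])
  refine tendsto_nhds_unique hc (hlim.congr fun k => ?_)
  have h1 := resolvent_complement_add hq hQ (hmem k)
  have h2 : w - Q w + t k • h k + (Q w + t k • c k) = w + t k • (h k + c k) := by module
  rw [← h2, h1, add_sub_cancel_left, inv_smul_smul₀ (ht k).ne']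

/-- By symmetry of `D`, the vector `(D v, -(v - D v))` annihilates every `(h - D h, D h)`. -/
theorem fderiv_mem_regularCoderivative (hq : IsProperConvexLsc q)
    (hQ : ∀ w, Q w ∈ subdifferential q (w - Q w)) {w : E} {D : E →L[ℝ] E}
    (hD : HasFDerivAt Q D w) (v : E) :
    D v ∈ regularCoderivative (subdifferential q) (w - Q w) (Q w) (v - D v) := by
  refine mem_regularCoderivative_iff.2 ⟨hQ w, fun a b hab => le_of_eq ?_⟩
  have hb := eq_fderiv_of_mem_contingentCone hq hQ hD hab
  have hs := inner_fderiv_resolvent_complement_symm hq hQ hD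
  have h1 : D a = b - D b := by rw [eq_sub_iff_add_eq, ← map_add, ← hb]
  rw [hs v a, h1, inner_sub_left, inner_sub_right, hs v b]

/-- By Rademacher's theorem `Q` is differentiable on a dense set, and a limit of its derivatives
supplies the matrix of the Newton step. -/
theorem exists_subdiff_operator [FiniteDimensional ℝ E] (hq : IsProperConvexLsc q) {d s : E}
    (hs : s ∈ subdifferential q d) :
    ∃ G : E →L[ℝ] E, (∀ v h, ⟪G v, h⟫ = ⟪v, G h⟫) ∧ (∀ v, 0 ≤ ⟪G v, v⟫) ∧ ‖G‖ ≤ 1 ∧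
      ∀ v, G v ∈ coderivative (subdifferential q) d s (v - G v) := by
  obtain ⟨Q, hQ⟩ := exists_resolvent_complement hq
  have hlip := resolvent_complement_lipschitz hq hQ
  have hdense : Dense {w | DifferentiableAt ℝ Q w} := by
    borelize E
    exact MeasureTheory.Measure.dense_of_ae
      (hlip.ae_differentiableAt (μ := MeasureTheory.Measure.addHaar))
  obtain ⟨w, hw, hlim⟩ := mem_closure_iff_seq_limit.1 (hdense (d + s))
  have hD : ∀ k, HasFDerivAt Q (fderiv ℝ Q (w k)) (w k) := fun k => (hw k).hasFDerivAt
  have hnorm : ∀ k, ‖fderiv ℝ Q (w k)‖ ≤ 1 := fun k => by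
    simpa using norm_fderiv_le_of_lipschitz ℝ hlip (x₀ := w k)
  obtain ⟨G, hG, φ, hφ, hGlim⟩ := (isCompact_closedBall (0 : E →L[ℝ] E) 1).tendsto_subseq
    (x := fun k => fderiv ℝ Q (w k)) (fun k => by simpa using hnorm k)
  have hGv : ∀ v, Tendsto (fun k => fderiv ℝ Q (w (φ k)) v) atTop (𝓝 (G v)) := fun v =>
    ((ContinuousLinearMap.apply ℝ E v).continuous.tendsto G).comp hGlim
  have hwφ := hlim.comp hφ.tendsto_atTop
  have hQφ : Tendsto (fun k => Q (w (φ k))) atTop (𝓝 s) := by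
    have := (hlip.continuous.tendsto (d + s)).comp hwφ
    rwa [resolvent_complement_add hq hQ hs] at this
  refine ⟨G, fun v h => ?_, fun v => ?_, by simpa using hG, fun v => ?_⟩
  · refine tendsto_nhds_unique ((hGv v).inner (tendsto_const_nhds (x := h))) ?_
    refine ((tendsto_const_nhds (x := v)).inner (hGv h)).congr fun k => ?_
    exact (inner_fderiv_resolvent_complement_symm hq hQ (hD _) v h).symm
  · refine ge_of_tendsto' ((hGv v).inner (tendsto_const_nhds (x := v))) fun k => ?_
    exact (sq_nonneg _).trans (norm_fderiv_resolvent_complement_sq_le hq hQ (hD _) v)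
  · refine mem_coderivative_iff.2 ⟨fun k => w (φ k) - Q (w (φ k)), fun k => Q (w (φ k)),
      fun k => fderiv ℝ Q (w (φ k)) v, fun k => v - fderiv ℝ Q (w (φ k)) v, ?_, hQφ, hGv v,
      tendsto_const_nhds.sub (hGv v), fun k => fderiv_mem_regularCoderivative hq hQ (hD _) v⟩
    simpa using hwφ.sub hQφ

end Resolvent

/-! ### Semismoothness* as a uniform estimate -/

section SemismoothEstimate

theorem regularNormalCone_smul {E : Type*} [NormedAddCommGroup E] [InnerProductSpace ℝ E]
    {A : Set E} {z n : E} {c : ℝ} (hc : 0 ≤ c) (hn : n ∈ regularNormalCone A z) :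
    c • n ∈ regularNormalCone A z :=
  ⟨hn.1, fun w hw => by
    rw [real_inner_smul_left]
    exact mul_nonpos_of_nonneg_of_nonpos hc (hn.2 w hw)⟩

/-- Semismoothness* of a set as a uniform estimate: limit directions and limit normals of a
violating sequence would contradict the condition on directional normals. -/
theorem regularNormalCone_inner_le {E : Type*} [NormedAddCommGroup E] [InnerProductSpace ℝ E]
    [FiniteDimensional ℝ E] {A : Set E} {z₀ : E}
    (hA : ∀ d, ∀ n ∈ directionalNormalCone A z₀ d, ⟪n, d⟫ = 0) {ε : ℝ} (hε : 0 < ε) :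
    ∃ δ > 0, ∀ z n, ‖z - z₀‖ < δ → n ∈ regularNormalCone A z →
      |⟪n, z - z₀⟫| ≤ ε * ‖z - z₀‖ * ‖n‖ := by
  by_contra! hcon
  choose z n hz hn hviol using fun k : ℕ =>
    hcon (1 / ((k : ℝ) + 1)) Nat.one_div_pos_of_nat
  have hz0 : ∀ k, 0 < ‖z k - z₀‖ := fun k => by
    rw [norm_pos_iff]
    intro h
    have := hviol k
    simp [h] at this
  have hn0 : ∀ k, 0 < ‖n k‖ := fun k => by
    rw [norm_pos_iff]
    intro h
    have := hviol k
    simp [h] at this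
  let p : ℕ → E × E := fun k => (‖z k - z₀‖⁻¹ • (z k - z₀), ‖n k‖⁻¹ • n k)
  have hp : ∀ k, p k ∈ Metric.closedBall (0 : E) 1 ×ˢ Metric.closedBall (0 : E) 1 := fun k => by
    constructor <;> simp [p, norm_smul, (hz0 k).ne', (hn0 k).ne']
  obtain ⟨⟨d, m⟩, -, φ, hφ, hlim⟩ := ((isCompact_closedBall (0 : E) 1).prod
    (isCompact_closedBall (0 : E) 1)).tendsto_subseq hp
  rw [Prod.tendsto_iff] at hlim
  have ht : Tendsto (fun k => ‖z k - z₀‖) atTop (𝓝 0) :=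
    squeeze_zero (fun _ => norm_nonneg _) (fun k => (hz k).le)
      tendsto_one_div_add_atTop_nhds_zero_nat
  have hm : m ∈ directionalNormalCone A z₀ d := by
    refine ⟨fun k => ‖z (φ k) - z₀‖, fun k => (p (φ k)).1, fun k => (p (φ k)).2,
      fun k => hz0 _, ht.comp hφ.tendsto_atTop, hlim.1, hlim.2, fun k => ?_⟩
    have : z₀ + ‖z (φ k) - z₀‖ • (p (φ k)).1 = z (φ k) := by
      simp only [p]
      rw [smul_inv_smul₀ (hz0 _).ne', add_sub_cancel]
    rw [this]
    exact regularNormalCone_smul (inv_nonneg.2 (norm_nonneg _)) (hn _)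
  have hge : ε ≤ |⟪m, d⟫| := by
    refine ge_of_tendsto' ((hlim.2.inner hlim.1).abs) fun k => ?_
    have h1 := hviol (φ k)
    simp only [Function.comp, p, real_inner_smul_left, real_inner_smul_right, abs_mul, abs_inv,
      abs_norm]
    rw [← mul_assoc, ← mul_inv, inv_mul_eq_div, le_div_iff₀ (mul_pos (hz0 _) (hn0 _))]
    linarith
  rw [hA d m hm, abs_zero] at hge
  exact absurd hge (not_le.2 hε)

theorem limitingNormalCone_inner_le {E : Type*} [NormedAddCommGroup E] [InnerProductSpace ℝ E]
    [FiniteDimensional ℝ E] {A : Set E} {z₀ : E}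
    (hA : ∀ d, ∀ n ∈ directionalNormalCone A z₀ d, ⟪n, d⟫ = 0) {ε : ℝ} (hε : 0 < ε) :
    ∃ δ > 0, ∀ z n, ‖z - z₀‖ < δ → n ∈ limitingNormalCone A z →
      |⟪n, z - z₀⟫| ≤ ε * ‖z - z₀‖ * ‖n‖ := by
  obtain ⟨δ, hδ, h⟩ := regularNormalCone_inner_le hA hε
  refine ⟨δ, hδ, fun z n hz ⟨a, b, ha, hb, hab⟩ => ?_⟩
  have ha' : Tendsto (fun k => a k - z₀) atTop (𝓝 (z - z₀)) := ha.sub_const z₀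
  refine le_of_tendsto_of_tendsto (hb.inner ha').abs ((ha'.norm.const_mul ε).mul hb.norm) ?_
  filter_upwards [ha'.norm.eventually_lt_const hz] with k hk
  exact h _ _ hk (hab k)

variable {E F : Type*} [NormedAddCommGroup E] [InnerProductSpace ℝ E]
  [NormedAddCommGroup F] [InnerProductSpace ℝ F]

theorem norm_toLp_prod_le {E F : Type*} [NormedAddCommGroup E] [NormedAddCommGroup F]
    (x : E) (y : F) : ‖WithLp.toLp 2 (x, y)‖ ≤ ‖x‖ + ‖y‖ := by
  rw [WithLp.prod_norm_eq_of_L2]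
  refine Real.sqrt_le_iff.2 ⟨by positivity, ?_⟩
  have := mul_nonneg (norm_nonneg x) (norm_nonneg y)
  change ‖x‖ ^ 2 + ‖y‖ ^ 2 ≤ (‖x‖ + ‖y‖) ^ 2
  nlinarith

/-- Semismoothness* controls coderivatives at all nearby points of the graph, not only directional
ones at the reference point. -/
theorem IsSemismoothStarAt.inner_sub_inner_le [FiniteDimensional ℝ E] [FiniteDimensional ℝ F]
    {Φ : E → Set F} {x₀ : E} {y₀ : F} (hΦ : IsSemismoothStarAt Φ x₀ y₀) {ε : ℝ} (hε : 0 < ε) :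
    ∃ δ > 0, ∀ x y u v, ‖x - x₀‖ < δ → ‖y - y₀‖ < δ → u ∈ coderivative Φ x y v →
      |⟪u, x - x₀⟫ - ⟪v, y - y₀⟫| ≤ ε * (‖x - x₀‖ + ‖y - y₀‖) * (‖u‖ + ‖v‖) := by
  have hA : ∀ d, ∀ n ∈ directionalNormalCone (graph Φ) (WithLp.toLp 2 (x₀, y₀)) d,
      ⟪n, d⟫ = 0 := by
    intro d n hn
    have h := hΦ.2 d.fst d.snd (-n.snd) n.fst (by
      simp only [directionalCoderivative, neg_neg]
      exact hn)
    rw [WithLp.prod_inner_apply]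
    rw [inner_neg_left] at h
    exact eq_neg_iff_add_eq_zero.1 h
  obtain ⟨δ, hδ, h⟩ := limitingNormalCone_inner_le hA hε
  refine ⟨δ / 2, half_pos hδ, fun x y u v hx hy hu => ?_⟩
  have hz : WithLp.toLp 2 (x, y) - WithLp.toLp 2 (x₀, y₀) = WithLp.toLp 2 (x - x₀, y - y₀) := rfl
  have h1 := norm_toLp_prod_le (x - x₀) (y - y₀)
  have h2 := norm_toLp_prod_le u (-v)
  rw [norm_neg] at h2
  have h3 := h _ _ (by rw [hz]; linarith) hu
  rw [hz, WithLp.prod_inner_apply] at h3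
  simp only [inner_neg_left, ← sub_eq_add_neg] at h3
  refine h3.trans ?_
  gcongr

end SemismoothEstimate

/-! ### Metric regularity and coderivatives -/

section MetricRegularity

variable {E : Type*} [NormedAddCommGroup E] [InnerProductSpace ℝ E] [FiniteDimensional ℝ E]
  {f : E → E} {q : E → EReal}

/-- Solving `y + t w ∈ H(x)` for small `t` with linear rate yields tangent vectors `(a, w - D a)`
to `gph ∂q`; testing a regular normal against them, with `w = -v`, bounds `v`. -/
theorem norm_le_of_mem_regularCoderivative {d s : E} {D : E →L[ℝ] E} {κ : ℝ≥0}
    (hD : HasFDerivAt f D d)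
    (hreg : ∀ᶠ y in 𝓝 (f d + s), Metric.infEDist d {z | y ∈ sumMap f q z} ≤
      κ * Metric.infEDist y (sumMap f q d))
    {u v : E} (hu : u ∈ regularCoderivative (subdifferential q) d s v) :
    ‖v‖ ≤ (κ + 1) * ‖D.adjoint v + u‖ := by
  rcases eq_or_ne v 0 with rfl | hv
  · rw [norm_zero]; positivity
  obtain ⟨hs, hu⟩ := mem_regularCoderivative_iff.1 hu
  have hv0 : 0 < ‖v‖ := norm_pos_iff.2 hv
  have hev : ∀ᶠ t : ℝ in 𝓝[>] 0, 0 < t ∧ ∃ a : E, ‖a‖ ≤ (κ + 1) * ‖v‖ ∧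
      f d + s - t • v - f (d + t • a) ∈ subdifferential q (d + t • a) := by
    have hlim : Tendsto (fun t : ℝ => f d + s - t • v) (𝓝[>] 0) (𝓝 (f d + s)) := by
      have : Continuous fun t : ℝ => f d + s - t • v := by fun_prop
      simpa using (this.tendsto 0).mono_left nhdsWithin_le_nhds
    filter_upwards [hlim.eventually hreg, self_mem_nhdsWithin] with t ht ht0
    have ht0 : 0 < t := ht0
    have h1 : Metric.infEDist (f d + s - t • v) (sumMap f q d) ≤ ENNReal.ofReal (t * ‖v‖) := by
      have hmem : f d + s ∈ sumMap f q d := ⟨s, hs, rfl⟩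
      refine (Metric.infEDist_le_edist_of_mem hmem).trans (le_of_eq ?_)
      rw [edist_dist, dist_eq_norm]
      congr 1
      rw [sub_sub_cancel_left, norm_neg, norm_smul, Real.norm_of_nonneg ht0.le]
    have h2 : Metric.infEDist d {z | f d + s - t • v ∈ sumMap f q z} <
        ENNReal.ofReal ((κ + 1) * (t * ‖v‖)) := by
      refine (ht.trans (mul_le_mul_right h1 _)).trans_lt ?_
      rw [← ENNReal.ofReal_coe_nnreal, ← ENNReal.ofReal_mul κ.coe_nonneg]
      exact (ENNReal.ofReal_lt_ofReal_iff (by positivity)).2 (by nlinarith [mul_pos ht0 hv0])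
    obtain ⟨z, ⟨s', hs', hz⟩, hdz⟩ := Metric.infEDist_lt_iff.1 h2
    rw [edist_comm, edist_dist, ENNReal.ofReal_lt_ofReal_iff (by positivity), dist_eq_norm] at hdz
    have hza : d + t • t⁻¹ • (z - d) = z := by rw [smul_inv_smul₀ ht0.ne', add_sub_cancel]
    refine ⟨ht0, t⁻¹ • (z - d), ?_, ?_⟩
    · rw [norm_smul, norm_inv, Real.norm_of_nonneg ht0.le, inv_mul_le_iff₀ ht0]
      linarith
    · rw [hza, hz, add_sub_cancel_left]
      exact hs'
  obtain ⟨t, ht, hta⟩ := exists_seq_forall_of_frequently hev.frequently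
  have ht0 : Tendsto t atTop (𝓝 0) := ht.mono_right nhdsWithin_le_nhds
  choose htpos a ha hmem using hta
  obtain ⟨a₀, ha₀, φ, hφ, hlim⟩ := (isCompact_closedBall (0 : E) ((κ + 1) * ‖v‖)).tendsto_subseq
    (x := a) (fun k => by simpa using ha k)
  have htφ := ht0.comp hφ.tendsto_atTop
  have hfd := (hD.hasFDerivWithinAt (s := Set.univ)).lim (l := atTop)
    (c := fun k => (t (φ k))⁻¹) (d := fun k => t (φ k) • a (φ k)) (v := a₀)
    (by simpa using htφ.smul hlim) (by simp)
    (hlim.congr fun k => by simp only [Function.comp, inv_smul_smul₀ (htpos (φ k)).ne'])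
  have hcone : WithLp.toLp 2 (a₀, -v - D a₀) ∈
      contingentCone (graph (subdifferential q)) (WithLp.toLp 2 (d, s)) := by
    refine mem_contingentCone_graph_iff.2 ⟨fun k => t (φ k), fun k => a (φ k), _,
      fun k => htpos _, htφ, hlim, tendsto_const_nhds.sub hfd, fun k => ?_⟩
    convert hmem (φ k) using 1
    rw [smul_sub, smul_inv_smul₀ (htpos (φ k)).ne', smul_neg]
    abel
  have h1 := hu _ _ hcone
  rw [inner_sub_right, inner_neg_right, real_inner_self_eq_norm_sq,
    ← ContinuousLinearMap.adjoint_inner_left] at h1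
  have h2 : ‖v‖ ^ 2 ≤ ‖D.adjoint v + u‖ * ‖a₀‖ := by
    have := neg_le_of_abs_le (abs_real_inner_le_norm (D.adjoint v + u) a₀)
    rw [inner_add_left] at this
    linarith
  have h3 : ‖a₀‖ ≤ (κ + 1) * ‖v‖ := by simpa using ha₀
  have h4 : ‖v‖ ^ 2 ≤ ‖D.adjoint v + u‖ * ((κ + 1) * ‖v‖) :=
    h2.trans (mul_le_mul_of_nonneg_left h3 (norm_nonneg _))
  nlinarith

/-- The necessity part of the Mordukhovich criterion for `H = f + ∂q`, uniformly near the
reference point. -/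
theorem IsMetricallyRegularAt.exists_coderivative_bound (hf : ContDiff ℝ 1 f) {x₀ : E}
    (hreg : IsMetricallyRegularAt (sumMap f q) x₀ 0) :
    ∃ κ > 0, ∃ δ > 0, ∀ d s u v, ‖d - x₀‖ < δ → ‖s + f x₀‖ < δ →
      u ∈ coderivative (subdifferential q) d s v →
      ‖v‖ ≤ κ * ‖(fderiv ℝ f d).adjoint v + u‖ := by
  obtain ⟨-, -, κ, U, hU, V, hV, h⟩ := hreg
  have hcont : Tendsto (fun p : E × E => f p.1 + p.2) (𝓝 (x₀, -f x₀)) (𝓝 0) := by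
    have : Continuous fun p : E × E => f p.1 + p.2 :=
      (hf.continuous.comp continuous_fst).add continuous_snd
    simpa using this.tendsto (x₀, -f x₀)
  have hev : ∀ᶠ p : E × E in 𝓝 (x₀, -f x₀), p.1 ∈ U ∧ ∀ᶠ y in 𝓝 (f p.1 + p.2), y ∈ V :=
    (continuous_fst.tendsto (x₀, -f x₀) |>.eventually hU).and
      (hcont.eventually (eventually_eventually_nhds.2 hV))
  obtain ⟨δ, hδ, hball⟩ := Metric.eventually_nhds_iff.1 hev
  have hregular : ∀ d s u v, ‖d - x₀‖ < δ → ‖s + f x₀‖ < δ →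
      u ∈ regularCoderivative (subdifferential q) d s v →
      ‖v‖ ≤ (κ + 1) * ‖(fderiv ℝ f d).adjoint v + u‖ := by
    intro d s u v hd hs hu
    obtain ⟨hdU, hy⟩ := @hball (d, s) (by
      rw [Prod.dist_eq, max_lt_iff, dist_eq_norm, dist_eq_norm, sub_neg_eq_add]
      exact ⟨hd, hs⟩)
    refine norm_le_of_mem_regularCoderivative
      ((hf.differentiable one_ne_zero).differentiableAt.hasFDerivAt) ?_ hu
    filter_upwards [hy] with y hyV using h d hdU y hyV
  refine ⟨κ + 1, by positivity, δ, hδ, fun d s u v hd hs hu => ?_⟩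
  obtain ⟨ds, ss, us, vs, hds, hss, hus, hvs, hmem⟩ := mem_coderivative_iff.1 hu
  have hD : Tendsto (fun k => (fderiv ℝ f (ds k)).adjoint (vs k)) atTop
      (𝓝 ((fderiv ℝ f d).adjoint v)) := by
    have h1 : Continuous fun x => (fderiv ℝ f x).adjoint :=
      ContinuousLinearMap.adjoint.continuous.comp (hf.continuous_fderiv one_ne_zero)
    have h2 : Tendsto (fun k => (fderiv ℝ f (ds k)).adjoint) atTop (𝓝 (fderiv ℝ f d).adjoint) :=
      (h1.tendsto d).comp hds
    have h3 : ∀ (A : ℕ → E →L[ℝ] E) (A₀ : E →L[ℝ] E), Tendsto A atTop (𝓝 A₀) →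
        Tendsto (fun k => A k (vs k)) atTop (𝓝 (A₀ v)) := fun A A₀ hA =>
      (isBoundedBilinearMap_apply.continuous.tendsto (A₀, v)).comp (hA.prodMk_nhds hvs)
    exact h3 _ _ h2
  refine le_of_tendsto_of_tendsto hvs.norm ((hD.add hus).norm.const_mul _) ?_
  filter_upwards [(hds.sub_const x₀).norm.eventually_lt_const hd,
    (hss.add_const (f x₀)).norm.eventually_lt_const hs] with k hk1 hk2
  exact hregular _ _ _ _ hk1 hk2 (hmem k)

end MetricRegularity

/-! ### The Newton step in operator form -/

section NewtonStep

variable {E : Type*} [NormedAddCommGroup E] [InnerProductSpace ℝ E]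
  {f : E → E} {q : E → EReal}

/-- In finite dimension a lower bound for the adjoint is a lower bound for the operator. -/
theorem norm_le_of_adjoint_bound [FiniteDimensional ℝ E] {N : E →L[ℝ] E} {K : ℝ}
    (hN : ∀ v, ‖v‖ ≤ K * ‖N.adjoint v‖) (h : E) : ‖h‖ ≤ K * ‖N h‖ := by
  have hinj : Function.Injective N.adjoint.toLinearMap := by
    rw [← LinearMap.ker_eq_bot, LinearMap.ker_eq_bot']
    intro v hv
    have := hN v
    rw [show N.adjoint v = 0 from hv, norm_zero, mul_zero] at this
    exact norm_le_zero_iff.1 this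
  obtain ⟨v, hv⟩ := LinearMap.surjective_of_injective hinj h
  have hv : N.adjoint v = h := hv
  have h1 : ‖h‖ ^ 2 ≤ ‖v‖ * ‖N h‖ := by
    rw [← real_inner_self_eq_norm_sq]
    nth_rewrite 1 [← hv]
    rw [ContinuousLinearMap.adjoint_inner_left]
    exact real_inner_le_norm _ _
  have h2 := hN v
  rw [hv] at h2
  rcases (norm_nonneg h).eq_or_lt with h0 | h0
  · rw [norm_eq_zero.1 h0.symm, map_zero, norm_zero, mul_zero]
  · have h3 := h1.trans (mul_le_mul_of_nonneg_right h2 (norm_nonneg (N h)))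
    nlinarith

/-- Operator form of an admissible matrix: `G` is symmetric and nonexpansive, and all pairs
`((I - G) v, G v)` lie in the graph of the coderivative of `∂q` at `(d, s)`. Positivity of `G` is
left out, as the error estimates only use symmetry and nonexpansiveness. -/
structure IsSubdiffOperator (q : E → EReal) (d s : E) (G : E →L[ℝ] E) : Prop where
  symm : ∀ v h, ⟪G v, h⟫ = ⟪v, G h⟫
  norm_le : ‖G‖ ≤ 1
  mem : ∀ v, G v ∈ coderivative (subdifferential q) d s (v - G v)

/-- The operator `(I - G) ∇f(x) + G` of the reduced Newton system. -/
noncomputable def newtonOperator (f : E → E) (G : E →L[ℝ] E) (x : E) : E →L[ℝ] E :=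
  (1 - G) * fderiv ℝ f x + G

theorem newtonOperator_apply (G : E →L[ℝ] E) (x h : E) :
    newtonOperator f G x h = fderiv ℝ f x h - G (fderiv ℝ f x h) + G h := rfl

theorem IsSubdiffOperator.norm_apply_le {d s : E} {G : E →L[ℝ] E} (hG : IsSubdiffOperator q d s G)
    (v : E) : ‖G v‖ ≤ ‖v‖ := by
  simpa using G.le_of_opNorm_le hG.norm_le v

theorem IsSubdiffOperator.adjoint_newtonOperator [FiniteDimensional ℝ E] {d s : E} {G : E →L[ℝ] E}
    (hG : IsSubdiffOperator q d s G) (x v : E) :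
    (newtonOperator f G x).adjoint v = (fderiv ℝ f x).adjoint (v - G v) + G v := by
  refine ext_inner_right ℝ fun h => ?_
  rw [ContinuousLinearMap.adjoint_inner_left, newtonOperator_apply, inner_add_left,
    ContinuousLinearMap.adjoint_inner_left, inner_add_right, inner_sub_left, inner_sub_right,
    hG.symm, hG.symm]

/-- Metric regularity makes the transposed Newton operators bounded below, uniformly in `G`. -/
theorem IsMetricallyRegularAt.exists_newtonOperator_bound [FiniteDimensional ℝ E]
    (hf : ContDiff ℝ 1 f) {x₀ : E}
    (hreg : IsMetricallyRegularAt (sumMap f q) x₀ 0) :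
    ∃ K > 0, ∃ δ > 0, ∀ x d s G, ‖x - x₀‖ < δ → ‖d - x₀‖ < δ → ‖s + f x₀‖ < δ →
      IsSubdiffOperator q d s G → ∀ h, ‖h‖ ≤ K * ‖newtonOperator f G x h‖ := by
  obtain ⟨κ, hκ, δ, hδ, hbound⟩ := hreg.exists_coderivative_bound hf
  obtain ⟨η, hη, hcont⟩ := Metric.continuousAt_iff.1
    (hf.continuous_fderiv one_ne_zero).continuousAt (min (1 / (4 * κ)) 1) (by positivity)
  set M := ‖fderiv ℝ f x₀‖ + 1 with hM
  refine ⟨1 + 2 * κ * M + 2 * κ, by positivity, min δ η, by positivity, ?_⟩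
  intro x d s G hx hd hs hG
  refine norm_le_of_adjoint_bound fun v => ?_
  have hxη := hcont (x := x) (by rw [dist_eq_norm]; exact hx.trans_le (min_le_right _ _))
  have hdη := hcont (x := d) (by rw [dist_eq_norm]; exact hd.trans_le (min_le_right _ _))
  rw [dist_eq_norm] at hxη hdη
  have hJx : ‖fderiv ℝ f x‖ ≤ M := by
    have := norm_le_norm_add_norm_sub' (fderiv ℝ f x) (fderiv ℝ f x₀)
    have := hxη.le.trans (min_le_right _ _)
    linarith
  have hJ : ‖fderiv ℝ f d - fderiv ℝ f x‖ ≤ 1 / (2 * κ) := by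
    have h1 := norm_sub_le_norm_sub_add_norm_sub (fderiv ℝ f d) (fderiv ℝ f x₀) (fderiv ℝ f x)
    rw [norm_sub_rev (fderiv ℝ f x₀)] at h1
    have h2 := hxη.le.trans (min_le_left _ _)
    have h3 := hdη.le.trans (min_le_left _ _)
    have h4 : 1 / (4 * κ) + 1 / (4 * κ) = 1 / (2 * κ) := by field_simp; norm_num
    linarith
  rw [hG.adjoint_newtonOperator]
  set w := v - G v with hw
  set c := (fderiv ℝ f x).adjoint w + G v with hc
  have h1 := hbound d s (G v) w (hd.trans_le (min_le_left _ _)) (hs.trans_le (min_le_left _ _))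
    (hG.mem v)
  have h2 : (fderiv ℝ f d).adjoint w + G v = c + (fderiv ℝ f d - fderiv ℝ f x).adjoint w := by
    rw [map_sub ContinuousLinearMap.adjoint, sub_apply, hc]; abel
  have h3 : ‖(fderiv ℝ f d - fderiv ℝ f x).adjoint w‖ ≤ 1 / (2 * κ) * ‖w‖ :=
    ContinuousLinearMap.le_of_opNorm_le _ (by rwa [LinearIsometryEquiv.norm_map]) w
  have h4 : ‖w‖ ≤ 2 * κ * ‖c‖ := by
    rw [h2] at h1
    have h5 := h1.trans (mul_le_mul_of_nonneg_left ((norm_add_le _ _).trans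
      (add_le_add_right h3 _)) hκ.le)
    have h6 : κ * (‖c‖ + 1 / (2 * κ) * ‖w‖) = κ * ‖c‖ + ‖w‖ / 2 := by field_simp
    linarith
  have h5 : ‖(fderiv ℝ f x).adjoint w‖ ≤ M * ‖w‖ :=
    ContinuousLinearMap.le_of_opNorm_le _ (by rwa [LinearIsometryEquiv.norm_map]) w
  have h6 : ‖G v‖ ≤ ‖c‖ + M * ‖w‖ := by
    have : G v = c - (fderiv ℝ f x).adjoint w := by rw [hc]; abel
    rw [this]
    exact (norm_sub_le _ _).trans (add_le_add_right h5 _)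
  have h7 : ‖v‖ ≤ ‖w‖ + ‖G v‖ := by
    simpa [hw] using norm_add_le (v - G v) (G v)
  have h8 : M * ‖w‖ ≤ M * (2 * κ * ‖c‖) := mul_le_mul_of_nonneg_left h4 (by positivity)
  linarith

/-- One Newton step from the approximation `d = x + u`, `s = -γ u - f(x)`, tested against `v`: the
residual splits into the linearization error of `f` and the quantity controlled by
semismoothness*. -/
theorem IsSubdiffOperator.inner_newtonOperator {x₀ x u x' s : E} {γ : ℝ} {G : E →L[ℝ] E}
    (hs : s = -(γ • u) - f x) (hG : IsSubdiffOperator q (x + u) s G)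
    (hstep : newtonOperator f G x (x' - x) = γ • (u - G u) + G u) (v : E) :
    ⟪v, newtonOperator f G x (x' - x₀)⟫ =
      ⟪v - G v, fderiv ℝ f x (x - x₀) - (f x - f x₀)⟫ +
        (⟪G v, x + u - x₀⟫ - ⟪v - G v, s + f x₀⟫) := by
  have h1 : x' - x₀ = (x' - x) + (x - x₀) := by abel
  have hsym : ∀ y, ⟪v - G v, y⟫ = ⟪v, y - G y⟫ := fun y => by
    rw [inner_sub_left, inner_sub_right, hG.symm]
  rw [h1, map_add, hstep, newtonOperator_apply, hsym, hsym, hG.symm, ← inner_sub_right,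
    ← inner_add_right, hs]
  congr 1
  simp only [map_sub, map_add, map_neg, map_smul]
  module

/-- The proximal displacement is controlled by the distance to the solution. -/
theorem norm_sub_le_of_mem_subdifferential (hq : IsProperConvexLsc q) {x₀ x u : E} {γ : ℝ}
    (hγ : 0 < γ) (h₀ : -f x₀ ∈ subdifferential q x₀)
    (hu : -(γ • u) - f x ∈ subdifferential q (x + u)) :
    ‖x + u - x₀‖ ≤ ‖x - x₀‖ + ‖f x - f x₀‖ / γ := by
  have h := subdifferential_monotone hq hu h₀
  set e := x + u - x₀ with he
  have h1 : -(γ • u) - f x - -f x₀ = γ • (x - x₀) - (f x - f x₀) - γ • e := by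
    rw [he]; module
  rw [h1, inner_sub_left _ (γ • e), real_inner_smul_left e, real_inner_self_eq_norm_sq] at h
  have h2 : γ * ‖e‖ ^ 2 ≤ (γ * ‖x - x₀‖ + ‖f x - f x₀‖) * ‖e‖ := by
    refine (sub_nonneg.1 h).trans ((real_inner_le_norm _ _).trans
      (mul_le_mul_of_nonneg_right ((norm_sub_le _ _).trans ?_) (norm_nonneg _)))
    rw [norm_smul, Real.norm_of_nonneg hγ.le]
  have h3 : γ * ‖e‖ ≤ γ * ‖x - x₀‖ + ‖f x - f x₀‖ := by
    rcases (norm_nonneg e).eq_or_lt with h0 | h0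
    · rw [← h0, mul_zero]; positivity
    · nlinarith
  have h4 : ‖x - x₀‖ + ‖f x - f x₀‖ / γ = (γ * ‖x - x₀‖ + ‖f x - f x₀‖) / γ := by field_simp
  rw [h4, le_div_iff₀ hγ]
  linarith

/-- Local superlinear estimate: near the solution the Newton operators are invertible, and a step
contracts the distance to the solution by an arbitrarily small factor. -/
theorem exists_newton_step_contraction [FiniteDimensional ℝ E] (hf : ContDiff ℝ 1 f)
    (hq : IsProperConvexLsc q) {x₀ : E}
    (hreg : IsMetricallyRegularAt (sumMap f q) x₀ 0)
    (hsemi : IsSemismoothStarAt (subdifferential q) x₀ (-f x₀)) {γ : ℝ} (hγ : 0 < γ)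
    {ε : ℝ} (hε : 0 < ε) :
    ∃ δ > 0, ∀ x u G, ‖x - x₀‖ < δ → -(γ • u) - f x ∈ subdifferential q (x + u) →
      IsSubdiffOperator q (x + u) (-(γ • u) - f x) G →
      Function.Injective (newtonOperator f G x) ∧
      ∀ x', newtonOperator f G x (x' - x) = γ • (u - G u) + G u →
        ‖x' - x₀‖ ≤ ε * ‖x - x₀‖ := by
  obtain ⟨K, hK, δ₁, hδ₁, hinv⟩ := hreg.exists_newtonOperator_bound hf
  set L := ‖fderiv ℝ f x₀‖ + 1 with hL
  set C := 1 + L / γ with hC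
  set C' := γ * (C + 1) + L with hC'
  have hL0 : 0 < L := by positivity
  have hC0 : 0 < C := by positivity
  have hC'0 : 0 < C' := by positivity
  -- `C` and `C'` bound `‖d - x₀‖` and `‖s + f x₀‖` by multiples of `‖x - x₀‖`. The linearization
  -- error contributes `4 η` to the residual and semismoothness* contributes `3 (C + C') η`.
  set η := ε / (K * (4 + 3 * (C + C'))) with hη
  have hη0 : 0 < η := by positivity
  obtain ⟨δ₂, hδ₂, hss⟩ := hsemi.inner_sub_inner_le hη0
  have hfd : HasFDerivAt f (fderiv ℝ f x₀) x₀ :=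
    (hf.differentiable one_ne_zero).differentiableAt.hasFDerivAt
  obtain ⟨δ₃, hδ₃, hlin⟩ := Metric.eventually_nhds_iff.1
    (hfd.isLittleO.def (c := min η 1) (by positivity))
  obtain ⟨δ₄, hδ₄, hcont⟩ := Metric.continuousAt_iff.1
    (hf.continuous_fderiv one_ne_zero).continuousAt η hη0
  set δ := min (min (δ₁ / (1 + C + C')) (δ₂ / (1 + C + C'))) (min δ₃ δ₄) with hδ
  refine ⟨δ, by positivity, fun x u G hx hu hG => ?_⟩
  set r := ‖x - x₀‖ with hr
  have hr0 : 0 ≤ r := norm_nonneg _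
  have hx₁ : r * (1 + C + C') < δ₁ := (lt_div_iff₀ (by positivity)).1
    (hx.trans_le ((min_le_left _ _).trans (min_le_left _ _)))
  have hx₂ : r * (1 + C + C') < δ₂ := (lt_div_iff₀ (by positivity)).1
    (hx.trans_le ((min_le_left _ _).trans (min_le_right _ _)))
  have hx₃ : dist x x₀ < δ₃ := by
    rw [dist_eq_norm]; exact hx.trans_le ((min_le_right _ _).trans (min_le_left _ _))
  have hx₄ : dist x x₀ < δ₄ := by
    rw [dist_eq_norm]; exact hx.trans_le ((min_le_right _ _).trans (min_le_right _ _))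
  have hlin' := hlin hx₃
  have hlin₁ : ‖f x - f x₀ - fderiv ℝ f x₀ (x - x₀)‖ ≤ η * r :=
    hlin'.trans (mul_le_mul_of_nonneg_right (min_le_left _ _) hr0)
  have hlin₂ : ‖f x - f x₀ - fderiv ℝ f x₀ (x - x₀)‖ ≤ 1 * r :=
    hlin'.trans (mul_le_mul_of_nonneg_right (min_le_right _ _) hr0)
  have hfL : ‖f x - f x₀‖ ≤ L * r := by
    have h1 := norm_le_norm_add_norm_sub' (f x - f x₀) (fderiv ℝ f x₀ (x - x₀))
    have h2 := (fderiv ℝ f x₀).le_opNorm (x - x₀)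
    rw [hL]; linarith
  have hd : ‖x + u - x₀‖ ≤ C * r := by
    refine (norm_sub_le_of_mem_subdifferential hq hγ hsemi.1 hu).trans ?_
    rw [hC, add_mul, one_mul, div_mul_eq_mul_div]
    gcongr
  have hs : ‖-(γ • u) - f x + f x₀‖ ≤ C' * r := by
    have h1 : ‖u‖ ≤ C * r + r := by
      have : u = (x + u - x₀) - (x - x₀) := by abel
      rw [this]
      exact (norm_sub_le _ _).trans (add_le_add_left hd _)
    have h2 : -(γ • u) - f x + f x₀ = -(γ • u) - (f x - f x₀) := by abel
    have h3 := norm_sub_le (-(γ • u)) (f x - f x₀)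
    rw [norm_neg, norm_smul, Real.norm_of_nonneg hγ.le] at h3
    have h4 := mul_le_mul_of_nonneg_left h1 hγ.le
    rw [h2, hC']
    linarith
  have hbound := hinv x (x + u) (-(γ • u) - f x) G (by nlinarith) (by nlinarith) (by nlinarith) hG
  refine ⟨?_, fun x' hx' => ?_⟩
  · refine (injective_iff_map_eq_zero _).2 fun h hh => ?_
    have := hbound h
    rw [hh, norm_zero, mul_zero] at this
    exact norm_le_zero_iff.1 this
  set v := newtonOperator f G x (x' - x₀) with hv
  have hres : ‖fderiv ℝ f x (x - x₀) - (f x - f x₀)‖ ≤ 2 * η * r := by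
    have h1 : fderiv ℝ f x (x - x₀) - (f x - f x₀) = (fderiv ℝ f x - fderiv ℝ f x₀) (x - x₀) -
        (f x - f x₀ - fderiv ℝ f x₀ (x - x₀)) := by
      rw [sub_apply]; abel
    have h2 : ‖(fderiv ℝ f x - fderiv ℝ f x₀) (x - x₀)‖ ≤ η * r :=
      ContinuousLinearMap.le_of_opNorm_le _ (by
        have := hcont hx₄
        rw [dist_eq_norm] at this
        exact this.le) _
    rw [h1]
    refine (norm_sub_le _ _).trans ?_
    linarith
  have hsemi' := hss (x + u) (-(γ • u) - f x) (G v) (v - G v) (by nlinarith)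
    (by rw [sub_neg_eq_add]; nlinarith) (hG.mem v)
  rw [sub_neg_eq_add] at hsemi'
  have hGv := hG.norm_apply_le v
  have hwv : ‖v - G v‖ ≤ 2 * ‖v‖ := (norm_sub_le _ _).trans (by linarith)
  have hsemi'' : ⟪G v, x + u - x₀⟫ - ⟪v - G v, -(γ • u) - f x + f x₀⟫ ≤
      η * (C * r + C' * r) * (‖v‖ + 2 * ‖v‖) :=
    (le_abs_self _).trans (hsemi'.trans (by gcongr))
  have hfirst : ⟪v - G v, fderiv ℝ f x (x - x₀) - (f x - f x₀)⟫ ≤ 2 * ‖v‖ * (2 * η * r) :=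
    (real_inner_le_norm _ _).trans (by gcongr)
  have hsq : ‖v‖ ^ 2 ≤ ‖v‖ * (η * (4 + 3 * (C + C')) * r) := by
    rw [← real_inner_self_eq_norm_sq, hv, hG.inner_newtonOperator rfl hx', ← hv]
    refine (add_le_add hfirst hsemi'').trans (le_of_eq ?_)
    ring
  have hvle : ‖v‖ ≤ η * (4 + 3 * (C + C')) * r := by
    rcases (norm_nonneg v).eq_or_lt with h0 | h0
    · rw [← h0]; positivity
    · rw [sq] at hsq; exact le_of_mul_le_mul_left hsq h0
  calc ‖x' - x₀‖ ≤ K * ‖v‖ := hbound _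
    _ ≤ K * (η * (4 + 3 * (C + C')) * r) := mul_le_mul_of_nonneg_left hvle hK.le
    _ = ε * r := by rw [hη]; field_simp

end NewtonStep

/-! ### Matrices acting on Euclidean vectors -/

section Matrices

variable {ι : Type*} [Fintype ι] [DecidableEq ι]

theorem act_mul (M N : Matrix ι ι ℝ) (v : EuclideanSpace ℝ ι) :
    act (M * N) v = act M (act N v) := by
  simp only [act, map_mul]; rfl

theorem act_add (M N : Matrix ι ι ℝ) (v : EuclideanSpace ℝ ι) :
    act (M + N) v = act M v + act N v := by
  simp only [act, map_add]; rfl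

theorem act_smul (c : ℝ) (M : Matrix ι ι ℝ) (v : EuclideanSpace ℝ ι) :
    act (c • M) v = c • act M v := by
  simp only [act, map_smul]; rfl

theorem act_one (v : EuclideanSpace ℝ ι) : act (1 : Matrix ι ι ℝ) v = v := by
  simp only [act, map_one]; rfl

theorem act_one_sub (G : Matrix ι ι ℝ) (v : EuclideanSpace ℝ ι) :
    act (1 - G) v = v - act G v := by
  simp only [act, map_sub, map_one]; rfl

theorem act_inv_mul_eq {A B : Matrix ι ι ℝ} (hA : IsUnit A.det) {y w : EuclideanSpace ℝ ι}
    (h : act A w = act B y) : act (A⁻¹ * B) y = w := by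
  rw [act_mul, ← h, ← act_mul, Matrix.nonsing_inv_mul _ hA, act_one]

theorem isUnit_det_of_injective_act {M : Matrix ι ι ℝ} (h : Function.Injective (act M)) :
    IsUnit M.det := by
  rw [← Matrix.isUnit_iff_isUnit_det, ← Matrix.mulVec_injective_iff_isUnit]
  intro a b hab
  have : act M (WithLp.toLp 2 a) = act M (WithLp.toLp 2 b) := congrArg (WithLp.toLp 2) hab
  exact congrArg WithLp.ofLp (h this)

theorem toLp_row_eq_adjoint (M : Matrix ι ι ℝ) (i : ι) :
    WithLp.toLp 2 (M i) = (Matrix.toEuclideanCLM (𝕜 := ℝ) M).adjoint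
      (EuclideanSpace.single i 1) := by
  refine ext_inner_right ℝ fun h => ?_
  rw [ContinuousLinearMap.adjoint_inner_left, EuclideanSpace.inner_single_left,
    Matrix.ofLp_toEuclideanCLM, map_one, one_mul, PiLp.inner_apply]
  simp only [Matrix.mulVec, dotProduct, RCLike.inner_apply, conj_trivial]
  exact Finset.sum_congr rfl fun j _ => mul_comm _ _

theorem adjoint_toEuclideanCLM_of_posSemidef {G : Matrix ι ι ℝ} (hG : G.PosSemidef) :
    (Matrix.toEuclideanCLM (𝕜 := ℝ) G).adjoint = Matrix.toEuclideanCLM (𝕜 := ℝ) G := by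
  rw [← ContinuousLinearMap.star_eq_adjoint, ← map_star, Matrix.star_eq_conjTranspose,
    hG.isHermitian.eq]

end Matrices

/-! ### Admissible matrices -/

section SubdiffMatrix

variable {n : ℕ} {f : EuclideanSpace ℝ (Fin n) → EuclideanSpace ℝ (Fin n)}
  {q : EuclideanSpace ℝ (Fin n) → EReal} {G : Matrix (Fin n) (Fin n) ℝ}
  {x d s : EuclideanSpace ℝ (Fin n)}

theorem act_jacobian (v : EuclideanSpace ℝ (Fin n)) : act (jacobian f x) v = fderiv ℝ f x v := by
  simp only [act, jacobian, StarAlgEquiv.apply_symm_apply]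

theorem act_newtonMatrix (v : EuclideanSpace ℝ (Fin n)) :
    act (newtonMatrix f G x) v =
      newtonOperator f (Matrix.toEuclideanCLM (𝕜 := ℝ) G) x v := by
  rw [newtonMatrix, act_add, act_mul, act_one_sub, act_jacobian, newtonOperator_apply]
  rfl

theorem IsSubdiffMatrix.isSubdiffOperator (hG : IsSubdiffMatrix q d s G) :
    IsSubdiffOperator q d s (Matrix.toEuclideanCLM (𝕜 := ℝ) G) where
  symm v h := by
    rw [← ContinuousLinearMap.adjoint_inner_right, adjoint_toEuclideanCLM_of_posSemidef hG.1]
  norm_le := hG.2.1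
  mem v := by
    have := hG.2.2 v
    rwa [act_one_sub] at this

theorem exists_isSubdiffMatrix (hq : IsProperConvexLsc q) (hs : s ∈ subdifferential q d) :
    ∃ G, IsSubdiffMatrix q d s G := by
  obtain ⟨T, hsymm, hpos, hnorm, hmem⟩ := exists_subdiff_operator hq hs
  have hT : Matrix.toEuclideanCLM (𝕜 := ℝ)
      ((Matrix.toEuclideanCLM (𝕜 := ℝ) (n := Fin n)).symm T) = T :=
    StarAlgEquiv.apply_symm_apply _ _
  refine ⟨(Matrix.toEuclideanCLM (𝕜 := ℝ) (n := Fin n)).symm T, ?_, by rwa [hT], fun v => ?_⟩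
  · rw [← Matrix.isPositive_toEuclideanLin_iff, ← Matrix.coe_toEuclideanCLM_eq_toEuclideanLin, hT]
    exact ⟨hsymm, hpos⟩
  · rw [act_one_sub, act, hT]
    exact hmem v

theorem IsReducedNewtonStep.newtonOperator_eq {γ : ℝ} {u x' : EuclideanSpace ℝ (Fin n)}
    (h : IsReducedNewtonStep f γ G u x x') :
    newtonOperator f (Matrix.toEuclideanCLM (𝕜 := ℝ) G) x (x' - x) =
      γ • (u - Matrix.toEuclideanCLM (𝕜 := ℝ) G u) + Matrix.toEuclideanCLM (𝕜 := ℝ) G u := by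
  rw [← act_newtonMatrix, h, act_add, act_smul, act_one_sub]
  rfl

end SubdiffMatrix

/-! ### Normals to the graph of the product map -/

section ProductMap

variable {n : ℕ} {f : EuclideanSpace ℝ (Fin n) → EuclideanSpace ℝ (Fin n)}
  {q : EuclideanSpace ℝ (Fin n) → EReal}

theorem exists_eq_pair (z : EuclideanSpace ℝ (Fin n ⊕ Fin n)) :
    ∃ a b : EuclideanSpace ℝ (Fin n), z = pair a b := by
  refine ⟨WithLp.toLp 2 fun i => z (Sum.inl i), WithLp.toLp 2 fun i => z (Sum.inr i), ?_⟩
  ext i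
  cases i <;> rfl

theorem pair_add_smul (a b c d : EuclideanSpace ℝ (Fin n)) (t : ℝ) :
    pair a b + t • pair c d = pair (a + t • c) (b + t • d) := by
  ext i
  cases i <;> rfl

theorem pair_sub (a b c d : EuclideanSpace ℝ (Fin n)) :
    pair a b - pair c d = pair (a - c) (b - d) := by
  ext i
  cases i <;> rfl

theorem inner_pair (a b c d : EuclideanSpace ℝ (Fin n)) :
    ⟪pair a b, pair c d⟫ = ⟪a, c⟫ + ⟪b, d⟫ := by
  simp only [PiLp.inner_apply, Fintype.sum_sum_type]
  rfl

theorem tendsto_pair {α : Type*} {l : Filter α} {a b : α → EuclideanSpace ℝ (Fin n)}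
    {x y : EuclideanSpace ℝ (Fin n)} :
    Tendsto (fun k => pair (a k) (b k)) l (𝓝 (pair x y)) ↔
      Tendsto a l (𝓝 x) ∧ Tendsto b l (𝓝 y) := by
  have hE : ∀ {ι : Type} [Fintype ι] (g : α → EuclideanSpace ℝ ι) (z : EuclideanSpace ℝ ι),
      Tendsto g l (𝓝 z) ↔ ∀ i, Tendsto (fun k => g k i) l (𝓝 (z i)) := by
    intro ι _ g z
    rw [← tendsto_pi_nhds]
    constructor
    · intro h
      exact ((PiLp.continuous_ofLp 2 _).tendsto _).comp h
    · intro h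
      exact ((PiLp.continuous_toLp 2 _).tendsto _).comp h
  rw [hE, hE, hE, Sum.forall]
  rfl

theorem pair_inj {a b c d : EuclideanSpace ℝ (Fin n)} : pair a b = pair c d ↔ a = c ∧ b = d := by
  constructor
  · intro h
    have h' := fun i => congrArg (fun z : EuclideanSpace ℝ (Fin n ⊕ Fin n) => z i) h
    exact ⟨by ext i; exact h' (Sum.inl i), by ext i; exact h' (Sum.inr i)⟩
  · rintro ⟨rfl, rfl⟩; rfl

theorem pair_mem_productMap_iff {x d y₁ y₂ : EuclideanSpace ℝ (Fin n)} :
    pair y₁ y₂ ∈ productMap f q (pair x d) ↔ y₁ - f x ∈ subdifferential q d ∧ y₂ = x - d := by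
  constructor
  · rintro ⟨x', d', s, hz, hs, hw⟩
    obtain ⟨rfl, rfl⟩ := pair_inj.1 hz
    obtain ⟨rfl, rfl⟩ := pair_inj.1 hw
    exact ⟨by rwa [add_sub_cancel_left], rfl⟩
  · rintro ⟨hs, rfl⟩
    exact ⟨x, d, y₁ - f x, rfl, hs, by rw [add_sub_cancel]⟩

theorem act_fromBlocks_pair (A B C D : Matrix (Fin n) (Fin n) ℝ)
    (a b : EuclideanSpace ℝ (Fin n)) :
    act (Matrix.fromBlocks A B C D) (pair a b) = pair (act A a + act B b) (act C a + act D b) := by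
  have h : (pair a b).ofLp = Sum.elim a.ofLp b.ofLp := rfl
  ext i
  simp only [act, Matrix.ofLp_toEuclideanCLM, h, Matrix.fromBlocks_mulVec]
  cases i <;> rfl

/-- A tangent vector `((a₁, a₂), (c₁, c₂))` to the graph of `𝓕` satisfies `c₂ = a₁ - a₂`, and
`(a₂, c₁ - ∇f(x) a₁)` is tangent to the graph of `∂q`. -/
theorem pair_mem_regularCoderivative_productMap {x d s u v : EuclideanSpace ℝ (Fin n)}
    (hf : DifferentiableAt ℝ f x) (hu : u ∈ regularCoderivative (subdifferential q) d s v)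
    (b : EuclideanSpace ℝ (Fin n)) :
    pair ((fderiv ℝ f x).adjoint v + b) (u - b) ∈
      regularCoderivative (productMap f q) (pair x d) (pair (f x + s) (x - d)) (pair v b) := by
  obtain ⟨hs, hu⟩ := mem_regularCoderivative_iff.1 hu
  refine mem_regularCoderivative_iff.2
    ⟨pair_mem_productMap_iff.2 ⟨by rwa [add_sub_cancel_left], rfl⟩, fun a c hac => ?_⟩
  obtain ⟨t, h, w, ht, ht0, hh, hw, hmem⟩ := mem_contingentCone_graph_iff.1 hac
  obtain ⟨a₁, a₂, rfl⟩ := exists_eq_pair a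
  obtain ⟨c₁, c₂, rfl⟩ := exists_eq_pair c
  choose h₁ h₂ hheq using fun k => exists_eq_pair (h k)
  choose w₁ w₂ hweq using fun k => exists_eq_pair (w k)
  obtain rfl : h = fun k => pair (h₁ k) (h₂ k) := funext hheq
  obtain rfl : w = fun k => pair (w₁ k) (w₂ k) := funext hweq
  obtain ⟨hh₁, hh₂⟩ := tendsto_pair.1 hh
  obtain ⟨hw₁, hw₂⟩ := tendsto_pair.1 hw
  simp only [pair_add_smul, pair_mem_productMap_iff] at hmem
  have hc₂ : c₂ = a₁ - a₂ := by
    refine tendsto_nhds_unique hw₂ ((hh₁.sub hh₂).congr fun k => ?_)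
    have h1 : t k • w₂ k = t k • (h₁ k - h₂ k) := by
      rw [smul_sub, ← add_right_inj (x - d), (hmem k).2]; abel
    exact (smul_right_injective _ (ht k).ne' h1).symm
  have hfd := (hf.hasFDerivAt.hasFDerivWithinAt (s := Set.univ)).lim (l := atTop)
    (c := fun k => (t k)⁻¹) (d := fun k => t k • h₁ k) (v := a₁)
    (by simpa using ht0.smul hh₁) (by simp)
    (hh₁.congr fun k => by simp only [inv_smul_smul₀ (ht k).ne'])
  have hcone : WithLp.toLp 2 (a₂, c₁ - fderiv ℝ f x a₁) ∈
      contingentCone (graph (subdifferential q)) (WithLp.toLp 2 (d, s)) := by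
    refine mem_contingentCone_graph_iff.2 ⟨t, h₂, _, ht, ht0, hh₂, hw₁.sub hfd, fun k => ?_⟩
    convert (hmem k).1 using 1
    rw [smul_sub, smul_inv_smul₀ (ht k).ne']
    abel
  have h1 := hu _ _ hcone
  rw [inner_sub_right, ← ContinuousLinearMap.adjoint_inner_left] at h1
  rw [inner_pair, inner_pair, hc₂, inner_add_left, inner_sub_left, inner_sub_right]
  linarith

/-- Normals to `gph ∂q` generate normals to `gph 𝓕`, by the chain rule for the diffeomorphism
that carries `gph ∂q` times a free variable to `gph 𝓕`. -/
theorem pair_mem_coderivative_productMap {x d s u v : EuclideanSpace ℝ (Fin n)}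
    (hf : DifferentiableAt ℝ f x) (hu : u ∈ coderivative (subdifferential q) d s v)
    (b : EuclideanSpace ℝ (Fin n)) :
    pair ((fderiv ℝ f x).adjoint v + b) (u - b) ∈
      coderivative (productMap f q) (pair x d) (pair (f x + s) (x - d)) (pair v b) := by
  obtain ⟨ds, ss, us, vs, hd, hs, hu, hv, hmem⟩ := mem_coderivative_iff.1 hu
  have hadj := ((fderiv ℝ f x).adjoint.continuous.tendsto v).comp hv
  exact mem_coderivative_iff.2 ⟨_, _, _, _, tendsto_pair.2 ⟨tendsto_const_nhds, hd⟩,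
    tendsto_pair.2 ⟨tendsto_const_nhds.add hs, tendsto_const_nhds.sub hd⟩,
    tendsto_pair.2 ⟨hadj.add tendsto_const_nhds, hu.sub tendsto_const_nhds⟩,
    tendsto_pair.2 ⟨hv, tendsto_const_nhds⟩,
    fun k => pair_mem_regularCoderivative_productMap hf (hmem k) b⟩

theorem fromBlocks_mem_regularMatrices {x d s : EuclideanSpace ℝ (Fin n)}
    {G : Matrix (Fin n) (Fin n) ℝ} (hf : DifferentiableAt ℝ f x) (hG : IsSubdiffMatrix q d s G)
    (hdet : IsUnit (newtonMatrix f G x).det) :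
    (Matrix.fromBlocks ((1 - G) * jacobian f x) G 1 (-1), Matrix.fromBlocks (1 - G) 0 0 1) ∈
      regularMatrices (productMap f q) (pair x d) (pair (f x + s) (x - d)) := by
  set T := Matrix.toEuclideanCLM (𝕜 := ℝ) (n := Fin n) with hT
  have hGadj : (T G).adjoint = T G := adjoint_toEuclideanCLM_of_posSemidef hG.1
  have hGadj' : (T (1 - G)).adjoint = T (1 - G) := by
    rw [map_sub, map_sub, hGadj, map_one]
    congr 1
    exact ContinuousLinearMap.adjoint_id
  have hrow : ∀ i, WithLp.toLp 2 (G i) = act G (EuclideanSpace.single i 1) := fun i => by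
    rw [toLp_row_eq_adjoint, hGadj, act]
  have hrow' : ∀ i, WithLp.toLp 2 ((1 - G) i) = act (1 - G) (EuclideanSpace.single i 1) :=
    fun i => by rw [toLp_row_eq_adjoint, hGadj', act]
  have hrowJ : ∀ i, WithLp.toLp 2 (((1 - G) * jacobian f x) i) =
      (fderiv ℝ f x).adjoint (act (1 - G) (EuclideanSpace.single i 1)) := fun i => by
    have hJ : T (jacobian f x) = fderiv ℝ f x := StarAlgEquiv.apply_symm_apply _ _
    rw [toLp_row_eq_adjoint, ← hT, map_mul, hJ, ContinuousLinearMap.mul_def,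
      ContinuousLinearMap.adjoint_comp, hGadj']
    rfl
  have hrow1 : ∀ i, WithLp.toLp 2 ((1 : Matrix (Fin n) (Fin n) ℝ) i) =
      EuclideanSpace.single i 1 := fun i => by
    ext j
    simp [Matrix.one_apply, eq_comm]
  refine ⟨fun i => ?_, ?_⟩
  · rcases i with i | i
    · have h := pair_mem_coderivative_productMap hf (hG.2.2 (EuclideanSpace.single i 1)) 0
      rw [add_zero, sub_zero, ← hrow, ← hrowJ, ← hrow'] at h
      exact h
    · -- the lower rows belong to the free variable alone, with the zero normal to `gph ∂q`
      have h0 := hG.2.2 0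
      simp only [act, map_zero] at h0
      have h := pair_mem_coderivative_productMap hf h0 (EuclideanSpace.single i 1)
      rw [map_zero, zero_add, zero_sub, ← hrow1] at h
      exact h
  · have h : IsUnit (-1 : Matrix (Fin n) (Fin n) ℝ).det := by
      rw [← Matrix.isUnit_iff_isUnit_det]
      exact isUnit_one.neg
    let _ := Matrix.invertibleOfIsUnitDet _ h
    rw [Matrix.det_fromBlocks₂₂]
    refine h.mul ?_
    have hinv : ⅟(-1 : Matrix (Fin n) (Fin n) ℝ) = -1 := invOf_eq_right_inv (by simp)
    rw [hinv, Matrix.mul_one, Matrix.mul_neg, Matrix.mul_one, sub_neg_eq_add]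
    exact hdet

/-- Eliminating the second block row of the Newton system for `𝓕` leaves the reduced system. -/
theorem IsReducedNewtonStep.isSemismoothNewtonStep {γ : ℝ} {x u x' : EuclideanSpace ℝ (Fin n)}
    {G : Matrix (Fin n) (Fin n) ℝ} (hf : DifferentiableAt ℝ f x)
    (hu : -(γ • u) - f x ∈ subdifferential q (x + u))
    (hG : IsSubdiffMatrix q (x + u) (-(γ • u) - f x) G)
    (hdet : IsUnit (newtonMatrix f G x).det) (h : IsReducedNewtonStep f γ G u x x') :
    IsSemismoothNewtonStep (productMap f q) (pair x (x + u)) (pair (-(γ • u)) (-u))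
      (Matrix.fromBlocks ((1 - G) * jacobian f x) G 1 (-1))
      (Matrix.fromBlocks (1 - G) 0 0 1) (pair x' x') := by
  have hy : pair (-(γ • u)) (-u) = pair (f x + (-(γ • u) - f x)) (x - (x + u)) := by
    rw [add_sub_cancel, sub_add_cancel_left]
  have hreg := fromBlocks_mem_regularMatrices hf hG hdet
  refine ⟨pair_mem_productMap_iff.2 ⟨hu, by abel⟩, hy ▸ hreg, ?_⟩
  have hlin : act (Matrix.fromBlocks ((1 - G) * jacobian f x) G 1 (-1))
      (pair (x - x') (x + u - x')) =
      act (Matrix.fromBlocks (1 - G) 0 0 1) (pair (-(γ • u)) (-u)) := by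
    rw [act_fromBlocks_pair, act_fromBlocks_pair, pair_inj]
    have h' := h.newtonOperator_eq
    rw [newtonOperator_apply] at h'
    have h1 : x - x' = -(x' - x) := by abel
    have h2 : x + u - x' = u - (x' - x) := by abel
    constructor
    · rw [act_mul, act_jacobian, act_one_sub, act_one_sub, h1, h2]
      simp only [act, map_neg, map_sub, map_smul, map_zero, zero_apply] at h' ⊢
      linear_combination (norm := module) (-1 : ℝ) • h'
    · simp only [act, map_neg, map_one, map_zero, zero_apply, neg_apply,
        one_apply_eq_self]
      abel
  rw [act_inv_mul_eq hreg.2 hlin, pair_sub]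
  simp

end ProductMap

/-! ### Local behaviour of the iteration -/

section Convergence

variable {n : ℕ} {f : EuclideanSpace ℝ (Fin n) → EuclideanSpace ℝ (Fin n)}
  {q : EuclideanSpace ℝ (Fin n) → EReal} {γ : ℝ} {x₀ x : EuclideanSpace ℝ (Fin n)}

theorem exists_iteration_contraction (hf : ContDiff ℝ 1 f) (hq : IsProperConvexLsc q)
    (hreg : IsMetricallyRegularAt (sumMap f q) x₀ 0)
    (hsemi : IsSemismoothStarAt (subdifferential q) x₀ (-f x₀)) (hγ : 0 < γ)
    {ε : ℝ} (hε : 0 < ε) :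
    ∃ δ > 0, ∀ x x', ‖x - x₀‖ < δ → IsIteration f q γ x x' → ‖x' - x₀‖ ≤ ε * ‖x - x₀‖ := by
  obtain ⟨δ, hδ, h⟩ := exists_newton_step_contraction hf hq hreg hsemi hγ hε
  refine ⟨δ, hδ, fun x x' hx ⟨_, u, G, hu, hG, hstep⟩ => ?_⟩
  exact (h x u _ hx (hu.mem_subdifferential hq) hG.isSubdiffOperator).2 x' hstep.newtonOperator_eq

/-- At every point near the reference point the iteration can be carried out. -/
theorem exists_isIterationWellDefined (hf : ContDiff ℝ 1 f) (hq : IsProperConvexLsc q)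
    (hreg : IsMetricallyRegularAt (sumMap f q) x₀ 0)
    (hsemi : IsSemismoothStarAt (subdifferential q) x₀ (-f x₀)) (hγ : 0 < γ) :
    ∃ δ > 0, ∀ x, ‖x - x₀‖ < δ → IsIterationWellDefined f q γ x := by
  obtain ⟨δ, hδ, h⟩ := exists_newton_step_contraction hf hq hreg hsemi hγ one_pos
  refine ⟨δ, hδ, fun x hx => ⟨?_, fun u hu => ?_⟩⟩
  · obtain ⟨u, hu⟩ := exists_isApproxStep hq f hγ x
    exact ⟨u, hu, fun v hv => hv.unique hq hγ hu⟩
  · have hmem := hu.mem_subdifferential hq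
    refine ⟨exists_isSubdiffMatrix hq hmem, fun G hG => ?_⟩
    have hdet : IsUnit (newtonMatrix f G x).det := by
      refine isUnit_det_of_injective_act ?_
      rw [funext act_newtonMatrix]
      exact (h x u _ hx hmem hG.isSubdiffOperator).1
    exact ⟨hdet, fun x' hx' => hx'.isSemismoothNewtonStep
      ((hf.differentiable one_ne_zero).differentiableAt) hmem hG hdet⟩

/-- The reference point is an isolated solution: at a solution `x` the Newton step with `u = 0`
returns `x` itself, so the contraction estimate forces `x = x₀`. -/
theorem exists_eq_of_zero_mem_sumMap (hf : ContDiff ℝ 1 f) (hq : IsProperConvexLsc q)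
    (hreg : IsMetricallyRegularAt (sumMap f q) x₀ 0)
    (hsemi : IsSemismoothStarAt (subdifferential q) x₀ (-f x₀)) :
    ∃ δ > 0, ∀ x, ‖x - x₀‖ < δ → 0 ∈ sumMap f q x → x = x₀ := by
  obtain ⟨δ, hδ, h⟩ := exists_newton_step_contraction hf hq hreg hsemi one_pos
    (one_half_pos : (0 : ℝ) < 1 / 2)
  refine ⟨δ, hδ, fun x hx ⟨s, hs, hxs⟩ => ?_⟩
  have hmem : -((1 : ℝ) • (0 : EuclideanSpace ℝ (Fin n))) - f x ∈ subdifferential q (x + 0) := by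
    rw [smul_zero, neg_zero, zero_sub, add_zero, ← eq_neg_of_add_eq_zero_right hxs.symm]
    exact hs
  obtain ⟨G, hG⟩ := exists_isSubdiffMatrix hq hmem
  have h1 := (h x 0 _ hx hmem hG.isSubdiffOperator).2 x (by simp)
  have h2 : ‖x - x₀‖ = 0 := le_antisymm (by linarith) (norm_nonneg _)
  exact sub_eq_zero.1 (norm_eq_zero.1 h2)

end Convergence

end SemismoothNewton

/-! ### Convergence of the method -/

theorem theorem4p6 (n : ℕ)
    (f : EuclideanSpace ℝ (Fin n) → EuclideanSpace ℝ (Fin n))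
    (q : EuclideanSpace ℝ (Fin n) → EReal)
    (hf : ContDiff ℝ 1 f) (hq : IsProperConvexLsc q)
    (xbar : EuclideanSpace ℝ (Fin n))
    (hreg : IsMetricallyRegularAt (sumMap f q) xbar 0)
    (hsemi : IsSemismoothStarAt (subdifferential q) xbar (-f xbar)) :
    ∀ γ : ℝ, 0 < γ → ∃ U ∈ 𝓝 xbar, ∀ x : ℕ → EuclideanSpace ℝ (Fin n), x 0 ∈ U →
      -- finite runs: the method stops only at `xbar`, and otherwise it can be continued
      (∀ N, (∀ k < N, IsIteration f q γ (x k) (x (k + 1))) →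
        (0 ∈ sumMap f q (x N) → x N = xbar) ∧
        (0 ∉ sumMap f q (x N) → IsIterationWellDefined f q γ (x N))) ∧
      -- infinite runs converge superlinearly to `xbar`
      ((∀ k, IsIteration f q γ (x k) (x (k + 1))) →
        Tendsto x atTop (𝓝 xbar) ∧
        (fun k => x (k + 1) - xbar) =o[atTop] (fun k => x k - xbar)) := by
  intro γ hγ
  obtain ⟨δ₁, hδ₁, hwell⟩ := exists_isIterationWellDefined hf hq hreg hsemi hγ
  obtain ⟨δ₂, hδ₂, hisol⟩ := exists_eq_of_zero_mem_sumMap hf hq hreg hsemi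
  obtain ⟨δ₃, hδ₃, hhalf⟩ := exists_iteration_contraction hf hq hreg hsemi hγ
    (one_half_pos : (0 : ℝ) < 1 / 2)
  set δ := min δ₁ (min δ₂ δ₃) with hδ
  have hδ0 : 0 < δ := lt_min hδ₁ (lt_min hδ₂ hδ₃)
  refine ⟨Metric.ball xbar δ, Metric.ball_mem_nhds _ hδ0, fun x hx0 => ?_⟩
  rw [mem_ball_iff_norm] at hx0
  have hgeom : ∀ N, (∀ k < N, IsIteration f q γ (x k) (x (k + 1))) →
      ‖x N - xbar‖ < δ ∧ ‖x N - xbar‖ ≤ (1 / 2) ^ N * ‖x 0 - xbar‖ := by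
    intro N
    induction N with
    | zero => exact fun _ => ⟨hx0, by simp⟩
    | succ N ih =>
      intro hN
      obtain ⟨h1, h2⟩ := ih fun k hk => hN k (hk.trans N.lt_succ_self)
      have h3 := hhalf _ _ (h1.trans_le ((min_le_right _ _).trans (min_le_right _ _)))
        (hN N N.lt_succ_self)
      refine ⟨by linarith [norm_nonneg (x N - xbar)], ?_⟩
      rw [pow_succ]
      linarith
  refine ⟨fun N hN => ⟨hisol _ ?_, fun _ => hwell _ ?_⟩, fun hit => ?_⟩
  · exact (hgeom N hN).1.trans_le ((min_le_right _ _).trans (min_le_left _ _))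
  · exact (hgeom N hN).1.trans_le (min_le_left _ _)
  have hlim : Tendsto (fun k => ‖x k - xbar‖) atTop (𝓝 0) := by
    refine squeeze_zero (fun _ => norm_nonneg _) (fun N => (hgeom N fun k _ => hit k).2) ?_
    have := (tendsto_pow_atTop_nhds_zero_of_lt_one (one_half_pos (α := ℝ)).le
      one_half_lt_one).mul_const ‖x 0 - xbar‖
    rwa [zero_mul] at this
  refine ⟨tendsto_iff_norm_sub_tendsto_zero.2 hlim, isLittleO_iff.2 fun ε hε => ?_⟩
  obtain ⟨η, hη, hcontr⟩ := exists_iteration_contraction hf hq hreg hsemi hγ hε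
  filter_upwards [hlim.eventually_lt_const hη] with k hk
  exact hcontr _ _ hk (hit k)
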